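/- Let $A$ be a C*-algebra (not necessarily unital). All Hilbert modules below are right Hilbert $A$-modules. Such a module $X$ is countably generated if there are $x_1,x_2,\dots\in X$ with $X=\overline{\sum_i x_iA}$. Write $\mathcal K(X)$ for the closed linear span of the operators $\theta_{y,x}(z)=y\langle x,z\rangle$ on $X$. A Hilbert submodule (closed $A$-submodule) $X_0\subseteq X$ is compactly contained in $X$, written $X_0\subset\subset X$, if some self-adjoint $T\in\mathcal K(X)$ restricts to the identity on $X_0$. For countably generated $X,Y$ write $X\precsim Y$ if every countably generated $X_0\subset\subset X$ is isomorphic, as a Hilbert module, to some $Y_0\subset\subset Y$, and $X\sim Y$ if $X\precsim Y$ and $Y\precsim X$. Let $\mathrm{Cu}(A)$ be the set of classes $[X]$ of countably generated Hilbert $A$-modules modulo $\sim$, partially ordered by $[X]\le[Y]\iff X\precsim Y$. In a partially ordered set write $x\ll y$ if, for every increasing sequence $(y_n)$ that has a supremum with $\sup_n y_n\ge y$, there is $n$ with $x\le y_n$. Upward directed sets are understood to be non-empty. **Theorem.** The operation $[X]+[Y]=[X\oplus Y]$ is well defined on $\mathrm{Cu}(A)$ and makes $\mathrm{Cu}(A)$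 an abelian semigroup such that: * (O1) the class $[0]$ of the zero module is a zero element; * (O2) if $x_i\le y_i$ for $i=1,2$, then $x_1+x_2\le y_1+y_2$; * (O3) every countable upward directed subset of $\mathrm{Cu}(A)$ has a supremum; * (O4) for every $x\in\mathrm{Cu}(A)$ the set $x^{\ll}=\{y : y\ll x\}$ is upward directed with respect to both $\le$ and $\ll$, and contains a sequence $x_1\ll x_2\ll\cdots$ with $\sup_n x_n=x$; * (O5) if $S_1,S_2$ are countable upward directed subsets of $\mathrm{Cu}(A)$, then $S_1+S_2$ is upward directed and $\sup(S_1+S_2)=\sup S_1+\sup S_2$; if $x_i\ll y_i$ for $i=1,2$, then $x_1+x_2\ll y_1+y_2$; * (O6) $x\ge 0$ for every $x\in\mathrm{Cu}(A)$. That is, $\mathrm{Cu}(A)$ is an object of the category $\mathsf{Cu}$. -/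

import Mathlib

open scoped Pointwise

universe u

namespace Cuntz

/-! ### Hilbert modules

Mathlib's `CStarModule B E` has an action of `B` on `E` and a `B`-valued inner product with
`⟪x, b • y⟫ = b * ⟪x, y⟫`.  For `B = Aᵐᵒᵖ` this is exactly a right inner product `A`-module: the right
action is `x a = MulOpposite.op a • x`, the `A`-valued inner product is
`⟨x, y⟩ = MulOpposite.unop (inner Aᵐᵒᵖ x y)`, and the axiom reads `⟨x, y a⟩ = ⟨x, y⟩ a`. -/

section Action

variable {B E : Type*} [NonUnitalCStarAlgebra B] [PartialOrder B] [SMul B E]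
  [NormedAddCommGroup E] [NormedSpace ℂ E] [CStarModule B E]

variable (B) in
theorem ext_inner {x y : E} (h : ∀ z : E, inner B z x = inner B z y) : x = y := by
  rw [← sub_eq_zero, ← CStarModule.inner_self (A := B), CStarModule.inner_sub_right, h, sub_self]

theorem smul_add' (b : B) (x y : E) : b • (x + y) = b • x + b • y :=
  ext_inner B fun z => by simp [mul_add]

theorem add_smul' (b c : B) (x : E) : (b + c) • x = b • x + c • x :=
  ext_inner B fun z => by simp [add_mul]

theorem mul_smul' (b c : B) (x : E) : (b * c) • x = b • (c • x) :=
  ext_inner B fun z => by simp [mul_assoc]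

theorem complex_smul_smul (r : ℂ) (b : B) (x : E) : (r • b) • x = r • (b • x) :=
  ext_inner B fun z => by simp [smul_mul_assoc]

theorem norm_smul_le' (b : B) (x : E) : ‖b • x‖ ≤ ‖b‖ * ‖x‖ := by
  refine abs_le_of_sq_le_sq' ?_ (by positivity) |>.2
  rw [mul_pow, CStarModule.norm_sq_eq B (x := b • x), CStarModule.norm_sq_eq B (x := x),
    CStarModule.inner_op_smul_right, CStarModule.inner_op_smul_left]
  calc ‖b * (inner B x x * star b)‖ ≤ ‖b‖ * (‖inner B x x‖ * ‖star b‖) :=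
        (norm_mul_le _ _).trans (by gcongr; exact norm_mul_le _ _)
    _ = ‖b‖ ^ 2 * ‖inner B x x‖ := by rw [norm_star]; ring

end Action

/-- A (right) Hilbert `A`-module: a right `A`-module with an `A`-valued inner product, complete for
the norm `‖x‖ ^ 2 = ‖⟨x, x⟩‖`. -/
structure HilbertModule (A : Type u) [NonUnitalCStarAlgebra A] [PartialOrder A] where
  carrier : Type u
  [normedAddCommGroup : NormedAddCommGroup carrier]
  [normedSpace : NormedSpace ℂ carrier]
  [smul : SMul Aᵐᵒᵖ carrier]
  [cstarModule : CStarModule Aᵐᵒᵖ carrier]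
  [completeSpace : CompleteSpace carrier]

namespace HilbertModule

variable {A : Type u} [NonUnitalCStarAlgebra A] [PartialOrder A]

instance : CoeSort (HilbertModule A) (Type u) := ⟨carrier⟩

attribute [instance] normedAddCommGroup normedSpace smul cstarModule completeSpace

/-- `X` is countably generated: there is a sequence `(xᵢ)` in `X` such that `∑ᵢ xᵢ A` is dense in
`X`. -/
def CountablyGenerated (X : HilbertModule A) : Prop :=
  ∃ x : ℕ → X,
    Dense (Submodule.span ℂ {z : X | ∃ (i : ℕ) (a : Aᵐᵒᵖ), z = a • x i} : Set X)

/-- An isomorphism of Hilbert `A`-modules: an `A`-linear bijection that preserves the inner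
product (in particular it is isometric). -/
structure Iso (X Y : HilbertModule A) where
  toLinearEquiv : X ≃ₗ[ℂ] Y
  map_smul : ∀ (a : Aᵐᵒᵖ) (x : X), toLinearEquiv (a • x) = a • toLinearEquiv x
  map_inner : ∀ x y : X, inner Aᵐᵒᵖ (toLinearEquiv x) (toLinearEquiv y) = inner Aᵐᵒᵖ x y

/-- The identity isomorphism. -/
def Iso.refl (X : HilbertModule A) : Iso X X :=
  ⟨LinearEquiv.refl ℂ X, fun _ _ => rfl, fun _ _ => rfl⟩

/-- Composition of isomorphisms. -/
def Iso.trans {X Y Z : HilbertModule A} (e : Iso X Y) (f : Iso Y Z) : Iso X Z :=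
  ⟨e.toLinearEquiv.trans f.toLinearEquiv,
    fun a x => by simp [e.map_smul, f.map_smul],
    fun x y => by simp [e.map_inner, f.map_inner]⟩

theorem Iso.norm_map {X Y : HilbertModule A} (e : Iso X Y) (x : X) : ‖e.toLinearEquiv x‖ = ‖x‖ := by
  rw [CStarModule.norm_eq_sqrt_norm_inner_self (A := Aᵐᵒᵖ), e.map_inner,
    ← CStarModule.norm_eq_sqrt_norm_inner_self (A := Aᵐᵒᵖ)]

theorem CountablyGenerated.of_iso {X Y : HilbertModule A} (h : X.CountablyGenerated)
    (e : Iso X Y) : Y.CountablyGenerated := by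
  obtain ⟨x, hx⟩ := h
  refine ⟨fun i => e.toLinearEquiv (x i), ?_⟩
  have hc : Continuous e.toLinearEquiv :=
    (AddMonoidHomClass.isometry_of_norm e.toLinearEquiv e.norm_map).continuous
  refine (e.toLinearEquiv.surjective.denseRange.dense_image hc hx).mono ?_
  rintro _ ⟨z, hz, rfl⟩
  refine Submodule.span_le (p := (Submodule.span ℂ
    {w : Y | ∃ (i : ℕ) (a : Aᵐᵒᵖ), w = a • e.toLinearEquiv (x i)}).comap
      e.toLinearEquiv.toLinearMap) |>.mpr ?_ hz
  rintro _ ⟨i, a, rfl⟩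
  exact Submodule.subset_span ⟨i, a, e.map_smul a (x i)⟩

/-- Hilbert submodules of `X`, that is, closed `A`-submodules. -/
structure HilbertSubmodule (X : HilbertModule A) extends Submodule ℂ X where
  smul_mem_right : ∀ (a : Aᵐᵒᵖ) {x : X}, x ∈ carrier → a • x ∈ carrier
  isClosed : IsClosed carrier

/-- A Hilbert submodule with the restricted operations is itself a Hilbert `A`-module. -/
noncomputable def HilbertSubmodule.toHilbertModule {X : HilbertModule A} (X₀ : HilbertSubmodule X) :
    HilbertModule A :=
  letI : SMul Aᵐᵒᵖ X₀.toSubmodule := ⟨fun a x => ⟨a • (x : X), X₀.smul_mem_right a x.2⟩⟩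
  letI : CStarModule Aᵐᵒᵖ X₀.toSubmodule :=
    { inner := fun x y => inner Aᵐᵒᵖ (x : X) (y : X)
      inner_add_right := CStarModule.inner_add_right
      inner_self_nonneg := CStarModule.inner_self_nonneg
      inner_self := fun {x} =>
        (CStarModule.inner_self (A := Aᵐᵒᵖ) (x := (x : X))).trans Submodule.coe_eq_zero
      inner_op_smul_right := CStarModule.inner_op_smul_right
      inner_smul_right_complex := CStarModule.inner_smul_right_complex
      star_inner := fun x y => CStarModule.star_inner (x : X) (y : X)
      norm_eq_sqrt_norm_inner_self := fun x =>
        CStarModule.norm_eq_sqrt_norm_inner_self (A := Aᵐᵒᵖ) (x : X) }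
  have : CompleteSpace X₀.toSubmodule := X₀.isClosed.completeSpace_coe
  { carrier := X₀.toSubmodule }

variable (A) in
/-- The zero Hilbert module. -/
noncomputable def zero : HilbertModule A :=
  letI : SMul Aᵐᵒᵖ PUnit.{u + 1} := ⟨fun _ _ => PUnit.unit⟩
  letI : CStarModule Aᵐᵒᵖ PUnit.{u + 1} :=
    { inner := fun _ _ => 0
      inner_add_right := by simp
      inner_self_nonneg := le_rfl
      inner_self := by simp
      inner_op_smul_right := by simp
      inner_smul_right_complex := by simp
      star_inner := by simp
      norm_eq_sqrt_norm_inner_self := by simp }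
  { carrier := PUnit.{u + 1} }

theorem countablyGenerated_zero : (zero A).CountablyGenerated := by
  have : Subsingleton (zero A) := inferInstanceAs (Subsingleton PUnit.{u + 1})
  refine ⟨fun _ => 0, fun z => ?_⟩
  rw [Subsingleton.elim z 0]
  exact subset_closure (Submodule.zero_mem _)

section StarOrdered

variable [StarOrderedRing A]

/-- The operator `θ_{y,x} : X → Y`, `z ↦ y ⟨x, z⟩`. -/
noncomputable def theta {X Y : HilbertModule A} (y : Y) (x : X) : X →L[ℂ] Y :=
  LinearMap.mkContinuous
    { toFun := fun z => (inner Aᵐᵒᵖ x z : Aᵐᵒᵖ) • y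
      map_add' := fun z w => by rw [CStarModule.inner_add_right, add_smul']
      map_smul' := fun r z => by
        rw [CStarModule.inner_smul_right_complex, complex_smul_smul, RingHom.id_apply] }
    (‖x‖ * ‖y‖) fun z =>
      calc ‖(inner Aᵐᵒᵖ x z : Aᵐᵒᵖ) • y‖ ≤ ‖(inner Aᵐᵒᵖ x z : Aᵐᵒᵖ)‖ * ‖y‖ := norm_smul_le' _ _
        _ ≤ ‖x‖ * ‖z‖ * ‖y‖ := by gcongr; exact CStarModule.norm_inner_le X
        _ = ‖x‖ * ‖y‖ * ‖z‖ := by ring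

/-- `𝒦(X)`, the compact operators on `X`: the closed linear span of the operators `θ_{y,x}`, for the
operator norm.  (Norm limits of adjointable operators are adjointable, so it does not matter whether
the closure is taken in the bounded or in the adjointable operators.) -/
noncomputable def compactOperators (X : HilbertModule A) : Submodule ℂ (X →L[ℂ] X) :=
  (Submodule.span ℂ {T | ∃ y x : X, T = theta y x}).topologicalClosure

/-- The Hilbert submodule `X₀` of `X` is compactly contained in `X`, `X₀ ⊂⊂ X`: there is a
self-adjoint compact operator on `X` that restricts to the identity of `X₀`. -/
def CompactlyContained {X : HilbertModule A} (X₀ : HilbertSubmodule X) : Prop :=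
  ∃ T ∈ compactOperators X,
    (∀ x y : X, inner Aᵐᵒᵖ (T x) y = inner Aᵐᵒᵖ x (T y)) ∧ ∀ x ∈ X₀.toSubmodule, T x = x

/-- The direct sum `X ⊕ Y`, with `⟨(x, y), (x', y')⟩ = ⟨x, x'⟩ + ⟨y, y'⟩`. -/
noncomputable def directSum (X Y : HilbertModule A) : HilbertModule A where
  carrier := WithCStarModule Aᵐᵒᵖ (X × Y)

theorem CountablyGenerated.directSum {X Y : HilbertModule A} (hX : X.CountablyGenerated)
    (hY : Y.CountablyGenerated) : (X.directSum Y).CountablyGenerated := by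
  obtain ⟨x, hx⟩ := hX
  obtain ⟨y, hy⟩ := hY
  let e : (X × Y) →L[ℂ] WithCStarModule Aᵐᵒᵖ (X × Y) :=
    ((WithCStarModule.equivL (A := Aᵐᵒᵖ) (E := X × Y) ℂ).symm).toContinuousLinearMap
  let f : X →L[ℂ] X.directSum Y :=
    e.comp (ContinuousLinearMap.inl ℂ X Y)
  let g : Y →L[ℂ] X.directSum Y :=
    e.comp (ContinuousLinearMap.inr ℂ X Y)
  have hf : ∀ (a : Aᵐᵒᵖ) (v : X), f (a • v) = a • f v := fun a v =>
    ext_inner Aᵐᵒᵖ fun w => by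
      change inner Aᵐᵒᵖ w.1 (a • v) + inner Aᵐᵒᵖ w.2 (0 : Y) = _
      rw [CStarModule.inner_op_smul_right, CStarModule.inner_op_smul_right]
      change _ = a * (inner Aᵐᵒᵖ w.1 v + inner Aᵐᵒᵖ w.2 (0 : Y))
      simp
  have hg : ∀ (a : Aᵐᵒᵖ) (v : Y), g (a • v) = a • g v := fun a v =>
    ext_inner Aᵐᵒᵖ fun w => by
      change inner Aᵐᵒᵖ w.1 (0 : X) + inner Aᵐᵒᵖ w.2 (a • v) = _
      rw [CStarModule.inner_op_smul_right, CStarModule.inner_op_smul_right]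
      change _ = a * (inner Aᵐᵒᵖ w.1 (0 : X) + inner Aᵐᵒᵖ w.2 v)
      simp
  let z : ℕ → X.directSum Y := fun n =>
    Sum.elim (fun i => f (x i)) (fun i => g (y i)) (Equiv.natSumNatEquivNat.symm n)
  refine ⟨z, ?_⟩
  set S := Submodule.span ℂ {w : X.directSum Y | ∃ (i : ℕ) (a : Aᵐᵒᵖ), w = a • z i} with hS
  have hfS : ∀ v : X, f v ∈ S.topologicalClosure := by
    have hcl : IsClosed {v : X | f v ∈ S.topologicalClosure} :=
      S.isClosed_topologicalClosure.preimage f.continuous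
    have hle : Submodule.span ℂ {z : X | ∃ (i : ℕ) (a : Aᵐᵒᵖ), z = a • x i} ≤
        S.topologicalClosure.comap f.toLinearMap := by
      rw [Submodule.span_le]
      rintro _ ⟨i, a, rfl⟩
      refine S.le_topologicalClosure (Submodule.subset_span
        ⟨Equiv.natSumNatEquivNat (Sum.inl i), a, ?_⟩)
      simpa [z] using hf a (x i)
    intro v
    exact hcl.closure_subset_iff.mpr hle (hx v)
  have hgS : ∀ v : Y, g v ∈ S.topologicalClosure := by
    have hcl : IsClosed {v : Y | g v ∈ S.topologicalClosure} :=
      S.isClosed_topologicalClosure.preimage g.continuous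
    have hle : Submodule.span ℂ {z : Y | ∃ (i : ℕ) (a : Aᵐᵒᵖ), z = a • y i} ≤
        S.topologicalClosure.comap g.toLinearMap := by
      rw [Submodule.span_le]
      rintro _ ⟨i, a, rfl⟩
      refine S.le_topologicalClosure (Submodule.subset_span
        ⟨Equiv.natSumNatEquivNat (Sum.inr i), a, ?_⟩)
      simpa [z] using hg a (y i)
    intro v
    exact hcl.closure_subset_iff.mpr hle (hy v)
  intro w
  have hw : w = f w.1 + g w.2 := by
    change w = ((w.1 + 0, 0 + w.2) : X × Y)
    rw [add_zero, zero_add]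
    rfl
  rw [hw]
  exact S.topologicalClosure.add_mem (hfS _) (hgS _)

end StarOrdered

end HilbertModule

open HilbertModule

/-- The countably generated Hilbert `A`-modules. -/
structure CGModule (A : Type u) [NonUnitalCStarAlgebra A] [PartialOrder A] where
  toHilbertModule : HilbertModule A
  countablyGenerated : toHilbertModule.CountablyGenerated

section Semigroup

variable {A : Type u} [NonUnitalCStarAlgebra A] [PartialOrder A] [StarOrderedRing A]

/-- Cuntz subequivalence `X ≾ Y`: every (countably generated) `X₀ ⊂⊂ X` is isomorphic to some
`Y₀ ⊂⊂ Y`. -/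
def CuntzSubequivalent (X Y : CGModule A) : Prop :=
  ∀ X₀ : HilbertSubmodule X.toHilbertModule, X₀.toHilbertModule.CountablyGenerated →
    CompactlyContained X₀ →
    ∃ Y₀ : HilbertSubmodule Y.toHilbertModule,
      CompactlyContained Y₀ ∧ Nonempty (Iso X₀.toHilbertModule Y₀.toHilbertModule)

theorem CuntzSubequivalent.refl (X : CGModule A) : CuntzSubequivalent X X :=
  fun X₀ _ h => ⟨X₀, h, ⟨Iso.refl _⟩⟩

theorem CuntzSubequivalent.trans {X Y Z : CGModule A} (hXY : CuntzSubequivalent X Y)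
    (hYZ : CuntzSubequivalent Y Z) : CuntzSubequivalent X Z := by
  intro X₀ hX₀ h
  obtain ⟨Y₀, hY, ⟨e⟩⟩ := hXY X₀ hX₀ h
  obtain ⟨Z₀, hZ, ⟨f⟩⟩ := hYZ Y₀ (hX₀.of_iso e) hY
  exact ⟨Z₀, hZ, ⟨e.trans f⟩⟩

instance : Preorder (CGModule A) where
  le := CuntzSubequivalent
  le_refl := CuntzSubequivalent.refl
  le_trans _ _ _ := CuntzSubequivalent.trans

variable (A) in
/-- `Cu(A)`: countably generated Hilbert `A`-modules modulo Cuntz equivalence (`X ≾ Y` and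
`Y ≾ X`), ordered by `[X] ≤ [Y]` if `X ≾ Y`.  (Isomorphic modules are Cuntz equivalent.) -/
def Cu : Type (u + 1) := Antisymmetrization (CGModule A) (· ≤ ·)

instance : PartialOrder (Cu A) :=
  inferInstanceAs (PartialOrder (Antisymmetrization (CGModule A) (· ≤ ·)))

/-- The class `[X]` of `X` in `Cu(A)`. -/
def Cu.mk (X : CGModule A) : Cu A := toAntisymmetrization (· ≤ ·) X

theorem Cu.mk_eq_mk_iff {X Y : CGModule A} :
    Cu.mk X = Cu.mk Y ↔ CuntzSubequivalent X Y ∧ CuntzSubequivalent Y X :=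
  Quotient.eq

theorem Cu.mk_le_mk_iff {X Y : CGModule A} : Cu.mk X ≤ Cu.mk Y ↔ CuntzSubequivalent X Y :=
  toAntisymmetrization_le_toAntisymmetrization_iff

variable (A) in
/-- The zero module. -/
noncomputable def CGModule.zero : CGModule A := ⟨HilbertModule.zero A, countablyGenerated_zero⟩

/-- The direct sum of countably generated modules. -/
noncomputable def CGModule.directSum (X Y : CGModule A) : CGModule A :=
  ⟨X.toHilbertModule.directSum Y.toHilbertModule, X.countablyGenerated.directSum Y.countablyGenerated⟩

end Semigroup

/-! ### The category `Cu` -/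

section CuCategory

/-- `x` is way below `y`, `x ≪ y`: whenever `(yₙ)` is an increasing sequence with a supremum
`s ≥ y`, then `x ≤ yₙ` for some `n`. -/
def WayBelow {S : Type*} [PartialOrder S] (x y : S) : Prop :=
  ∀ (v : ℕ → S) (s : S), Monotone v → IsLUB (Set.range v) s → y ≤ s → ∃ n, x ≤ v n

/-- The objects of the category `Cu`, among the partially ordered abelian semigroups with a zero
element (the existence of a zero element is axiom O1). -/
structure IsCuObject (S : Type*) [AddCommMonoid S] [PartialOrder S] : Prop where
  /-- O2: addition is compatible with the order. -/
  add_le_add : ∀ x₁ x₂ y₁ y₂ : S, x₁ ≤ y₁ → x₂ ≤ y₂ → x₁ + x₂ ≤ y₁ + y₂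
  /-- O3: countable upward directed sets have suprema. -/
  exists_isLUB : ∀ D : Set S, D.Countable → D.Nonempty → DirectedOn (· ≤ ·) D → ∃ s, IsLUB D s
  /-- O4: the set of elements way below `x` is upward directed for `≤` -/
  directedOn_le : ∀ x : S, DirectedOn (· ≤ ·) {y : S | WayBelow y x}
  /-- O4, continued: and for `≪` -/
  directedOn_wayBelow : ∀ x : S, DirectedOn WayBelow {y : S | WayBelow y x}
  /-- O4, continued: and it contains a rapidly increasing sequence with supremum `x`. -/
  exists_rapidly_increasing : ∀ x : S, ∃ v : ℕ → S,
    (∀ n, WayBelow (v n) x) ∧ (∀ n, WayBelow (v n) (v (n + 1))) ∧ IsLUB (Set.range v) x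
  /-- O5: sums of countable upward directed sets are upward directed -/
  directedOn_add : ∀ D₁ D₂ : Set S, D₁.Countable → D₁.Nonempty → DirectedOn (· ≤ ·) D₁ →
    D₂.Countable → D₂.Nonempty → DirectedOn (· ≤ ·) D₂ → DirectedOn (· ≤ ·) (D₁ + D₂)
  /-- O5, continued: and suprema of such sets are compatible with addition -/
  isLUB_add : ∀ D₁ D₂ : Set S, D₁.Countable → D₁.Nonempty → DirectedOn (· ≤ ·) D₁ →
    D₂.Countable → D₂.Nonempty → DirectedOn (· ≤ ·) D₂ →
    ∀ s₁ s₂ : S, IsLUB D₁ s₁ → IsLUB D₂ s₂ → IsLUB (D₁ + D₂) (s₁ + s₂)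
  /-- O5, continued: and so is `≪`. -/
  wayBelow_add : ∀ x₁ x₂ y₁ y₂ : S, WayBelow x₁ y₁ → WayBelow x₂ y₂ →
    WayBelow (x₁ + x₂) (y₁ + y₂)
  /-- O6: every element is positive. -/
  zero_le : ∀ x : S, 0 ≤ x

end CuCategory

end Cuntz

/-!
The proof replaces submodules by embeddings. An *embedding* `i : W → X` of Hilbert modules
preserves the inner product (`IsEmbedding`; it need not be adjointable), and `W` *embeds compactly*
in `X` if some self-adjoint compact operator on `X` fixes the image pointwise (`CompactlyEmbeds`;
`W ⋐ X` for countably generated modules). Then `X ≾ Y` says that `W ⋐ X` implies `W ⋐ Y` for all `W`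
(`CGModule.le_iff`). Four facts carry the theorem.

* Compact operators extend along embeddings without increasing the norm, so that `W ⋐ X` and an
  embedding of `X` in `Y` give `W ⋐ Y` (`CompactlyEmbeds.comp_right`).
* If the increasing union of submodules `Vₙ` is dense in `Z` and `W ⋐ Z`, then `W ⋐ Vₙ` for some
  `n` (`CompactlyEmbeds.exists_of_dense`). A compact `T` that fixes `W` is close to a map
  `S : Z → Vₙ`, so `S* S` is close to `T ^ 2`; with `p = f(T)`, where `f(1) = 1` and `f` vanishes on
  `(-∞, 1/2]`, the product `p S* S p` dominates a multiple of `p ^ 2`, and a polar decomposition of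
  `S p` yields an adjointable `V : Z → Vₙ` with `V* V = p ^ 2`, which is isometric on `W`
  (`exists_isometric_on_fixed`). This takes place in the C*-algebra `adjointable Z` and rests on
  `exists_seq_conj_tendsto`.
* A countably generated `X` is the closure of an increasing union of compactly contained
  submodules, the closures of the ranges of the spectral cut-offs of `h = ∑ cᵢ θ_{xᵢ,xᵢ}`
  (`exists_exhaustion`).
* Sequences of embeddings have inductive limits (`exists_inductiveLimit`): the completion of the
  module of eventually compatible sequences.

For `X₁ ≾ X₂ ≾ ⋯`, one chooses `Yₙ` in an exhaustion of `Xₙ` with `Yₙ ⋐ Yₙ₊₁`, and so large that it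
absorbs more and more of the exhaustions of `X₁, …, Xₙ`. The limit `Z` of the `Yₙ` satisfies
`Xₙ ≾ Z`, and `W ⋐ Z` implies `W ⋐ Xₙ` for some `n` (`CGModule.exists_sup`); so `[Z]` is the
supremum of the `[Xₙ]`, and `W ⋐ X` implies `[W] ≪ [X]`. The remaining axioms follow formally, those
on sums because the direct sums of the members of two exhaustions exhaust the direct sum.
-/

set_option linter.unusedSectionVars false

namespace Cuntz

open HilbertModule Filter Topology UniformSpace

variable {A : Type u} [NonUnitalCStarAlgebra A] [PartialOrder A] [StarOrderedRing A]

/-! ### Adjointable maps between Hilbert modules -/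

/-- `S : X → Y` and `S' : Y → X` are adjoint to each other: `⟨S x, y⟩ = ⟨x, S' y⟩`. -/
def IsAdjointPair {X Y : HilbertModule A} (S : X →L[ℂ] Y) (S' : Y →L[ℂ] X) : Prop :=
  ∀ x y, inner Aᵐᵒᵖ (S x) y = inner Aᵐᵒᵖ x (S' y)

namespace IsAdjointPair

variable {X Y Z : HilbertModule A} {S T : X →L[ℂ] Y} {S' T' : Y →L[ℂ] X}

theorem symm (h : IsAdjointPair S S') : IsAdjointPair S' S := fun y x => by
  rw [← CStarModule.star_inner, ← h, CStarModule.star_inner]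

theorem add (h : IsAdjointPair S S') (k : IsAdjointPair T T') :
    IsAdjointPair (S + T) (S' + T') := fun x y => by
  simp [h x y, k x y]

theorem sub (h : IsAdjointPair S S') (k : IsAdjointPair T T') :
    IsAdjointPair (S - T) (S' - T') := fun x y => by
  simp [h x y, k x y]

theorem smul (h : IsAdjointPair S S') (c : ℂ) : IsAdjointPair (c • S) (star c • S') :=
  fun x y => by
    simp [CStarModule.inner_smul_left_complex, CStarModule.inner_smul_right_complex, h x y]

theorem comp {U : Y →L[ℂ] Z} {U' : Z →L[ℂ] Y} (k : IsAdjointPair U U') (h : IsAdjointPair S S') :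
    IsAdjointPair (U ∘L S) (S' ∘L U') := fun x z => by
  simp [k _ z, h x]

/-- An adjointable map is `A`-linear. -/
theorem map_smul (h : IsAdjointPair S S') (a : Aᵐᵒᵖ) (x : X) : S (a • x) = a • S x :=
  ext_inner Aᵐᵒᵖ fun y => by
    rw [← h.symm, CStarModule.inner_op_smul_right,
      CStarModule.inner_op_smul_right, h.symm]

theorem unique {S'' : Y →L[ℂ] X} (h : IsAdjointPair S S') (k : IsAdjointPair S S'') : S' = S'' := by
  ext y
  exact ext_inner Aᵐᵒᵖ fun x => by rw [← h, ← k]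

theorem norm_apply_le (h : IsAdjointPair S S') (y : Y) : ‖S' y‖ ≤ ‖S‖ * ‖y‖ := by
  rcases (norm_nonneg (S' y)).eq_or_lt with h0 | h0
  · rw [← h0]; positivity
  refine le_of_mul_le_mul_right ?_ h0
  calc ‖S' y‖ * ‖S' y‖ = ‖(inner Aᵐᵒᵖ (S (S' y)) y : Aᵐᵒᵖ)‖ := by
        rw [h, ← CStarModule.norm_sq_eq Aᵐᵒᵖ, sq]
    _ ≤ ‖S (S' y)‖ * ‖y‖ := CStarModule.norm_inner_le Y
    _ ≤ ‖S‖ * ‖S' y‖ * ‖y‖ := by gcongr; exact S.le_opNorm _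
    _ = _ := by ring

theorem norm_eq (h : IsAdjointPair S S') : ‖S'‖ = ‖S‖ :=
  le_antisymm (S'.opNorm_le_bound (norm_nonneg _) h.norm_apply_le)
    (S.opNorm_le_bound (norm_nonneg _) h.symm.norm_apply_le)

/-- Adjoint pairs are closed under norm limits. -/
theorem of_tendsto {ι : Type*} {l : Filter ι} [l.NeBot] {F : ι → X →L[ℂ] Y} {F' : ι → Y →L[ℂ] X}
    (h : ∀ i, IsAdjointPair (F i) (F' i)) (hF : Tendsto F l (𝓝 S)) (hF' : Tendsto F' l (𝓝 S')) :
    IsAdjointPair S S' := fun x y => by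
  have h1 : Tendsto (fun i => (inner Aᵐᵒᵖ (F i x) y : Aᵐᵒᵖ)) l (𝓝 (inner Aᵐᵒᵖ (S x) y)) :=
    (CStarModule.continuous_inner (A := Aᵐᵒᵖ) (E := Y)).continuousAt.tendsto.comp
      (((ContinuousLinearMap.apply ℂ Y x).continuous.tendsto S |>.comp hF).prodMk_nhds
        (tendsto_const_nhds (x := y)))
  have h2 : Tendsto (fun i => (inner Aᵐᵒᵖ x (F' i y) : Aᵐᵒᵖ)) l (𝓝 (inner Aᵐᵒᵖ x (S' y))) :=
    (CStarModule.continuous_inner (A := Aᵐᵒᵖ) (E := X)).continuousAt.tendsto.comp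
      ((tendsto_const_nhds (x := x)).prodMk_nhds
        ((ContinuousLinearMap.apply ℂ X y).continuous.tendsto S' |>.comp hF'))
  refine tendsto_nhds_unique (h1.congr fun i => h i x y) h2

/-- A Cauchy sequence of adjointable maps converges to an adjointable map, along with the
adjoints. -/
theorem exists_tendsto {F : ℕ → X →L[ℂ] Y} {F' : ℕ → Y →L[ℂ] X}
    (h : ∀ i, IsAdjointPair (F i) (F' i)) (hF : CauchySeq F) :
    ∃ S S', IsAdjointPair S S' ∧ Tendsto F atTop (𝓝 S) ∧ Tendsto F' atTop (𝓝 S') := by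
  have hF' : CauchySeq F' := by
    rw [Metric.cauchySeq_iff] at hF ⊢
    simpa only [dist_eq_norm, fun m n => ((h m).sub (h n)).norm_eq] using hF
  obtain ⟨S, hS⟩ := cauchySeq_tendsto_of_complete hF
  obtain ⟨S', hS'⟩ := cauchySeq_tendsto_of_complete hF'
  exact ⟨S, S', of_tendsto h hS hS', hS, hS'⟩

end IsAdjointPair

section Theta

variable {X Y Z : HilbertModule A}

@[simp]
theorem theta_apply (y : Y) (x z : X) : theta y x z = (inner Aᵐᵒᵖ x z : Aᵐᵒᵖ) • y := rfl

theorem isAdjointPair_theta (y : Y) (x : X) : IsAdjointPair (theta y x) (theta x y) := fun z w => by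
  simp

theorem norm_theta_le (y : Y) (x : X) : ‖theta y x‖ ≤ ‖x‖ * ‖y‖ :=
  LinearMap.mkContinuous_norm_le _ (by positivity) _

theorem theta_sub_left (y y' : Y) (x : X) : theta (y - y') x = theta y x - theta y' x := by
  ext z
  refine ext_inner Aᵐᵒᵖ fun w => ?_
  simp [mul_sub]

theorem norm_theta_self (x : X) : ‖theta x x‖ = ‖x‖ ^ 2 := by
  refine le_antisymm ((norm_theta_le x x).trans_eq (sq _).symm) ?_
  rcases (norm_nonneg x).eq_or_lt with h0 | h0
  · rw [← h0]; simp
  refine le_of_mul_le_mul_right ?_ (pow_pos h0 2)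
  -- `⟨x, θ x⟩ = ⟨x, x⟩ ^ 2` has norm `‖x‖ ^ 4`
  calc ‖x‖ ^ 2 * ‖x‖ ^ 2 = ‖(inner Aᵐᵒᵖ x (theta x x x) : Aᵐᵒᵖ)‖ := by
        rw [theta_apply, CStarModule.inner_op_smul_right]
        conv_rhs => enter [1, 1]; rw [← CStarModule.star_inner]
        rw [CStarRing.norm_star_mul_self, CStarModule.norm_sq_eq Aᵐᵒᵖ]
    _ ≤ ‖x‖ * ‖theta x x x‖ := CStarModule.norm_inner_le X
    _ ≤ ‖x‖ * (‖theta x x‖ * ‖x‖) := by gcongr; exact ContinuousLinearMap.le_opNorm _ _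
    _ = _ := by ring

theorem theta_comp {S : X →L[ℂ] Y} {S' : Y →L[ℂ] X} (h : IsAdjointPair S S') (z : Z) (y : Y) :
    theta z y ∘L S = theta z (S' y) := by
  ext x
  simp [h.symm y x]

theorem comp_theta {S : Y →L[ℂ] Z} {S' : Z →L[ℂ] Y} (h : IsAdjointPair S S') (y : Y) (x : X) :
    S ∘L theta y x = theta (S y) x := by
  ext z
  simp [h.map_smul]

theorem theta_mem_compactOperators (y x : X) : theta y x ∈ compactOperators X :=
  Submodule.le_topologicalClosure _ (Submodule.subset_span ⟨y, x, rfl⟩)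

theorem isClosed_compactOperators : IsClosed (compactOperators X : Set (X →L[ℂ] X)) :=
  Submodule.isClosed_topologicalClosure _

/-- A closed condition that is linear and holds for the operators `θ_{y,x}` holds for all compact
operators. -/
theorem compactOperators_le {K : Submodule ℂ (X →L[ℂ] X)} (hK : IsClosed (K : Set (X →L[ℂ] X)))
    (h : ∀ y x : X, theta y x ∈ K) : compactOperators X ≤ K :=
  Submodule.topologicalClosure_minimal _
    (Submodule.span_le.mpr (by rintro _ ⟨y, x, rfl⟩; exact h y x)) hK

theorem conj_mem_compactOperators {V : X →L[ℂ] Y} {V' : Y →L[ℂ] X} (h : IsAdjointPair V V')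
    {T : X →L[ℂ] X} (hT : T ∈ compactOperators X) : V ∘L T ∘L V' ∈ compactOperators Y := by
  let Φ : (X →L[ℂ] X) →L[ℂ] (Y →L[ℂ] Y) :=
    (ContinuousLinearMap.compL ℂ Y X Y V) ∘L ((ContinuousLinearMap.compL ℂ Y X X).flip V')
  refine compactOperators_le (K := (compactOperators Y).comap Φ.toLinearMap)
    (isClosed_compactOperators.preimage Φ.continuous) (fun y x => ?_) hT
  change V ∘L (theta y x ∘L V') ∈ compactOperators Y
  rw [theta_comp h.symm, comp_theta h]
  exact theta_mem_compactOperators _ _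

theorem comp_mem_compactOperators {V V' : X →L[ℂ] X} (h : IsAdjointPair V V')
    {T : X →L[ℂ] X} (hT : T ∈ compactOperators X) : T ∘L V ∈ compactOperators X := by
  let Φ : (X →L[ℂ] X) →L[ℂ] (X →L[ℂ] X) := (ContinuousLinearMap.compL ℂ X X X).flip V
  refine compactOperators_le (K := (compactOperators X).comap Φ.toLinearMap)
    (isClosed_compactOperators.preimage Φ.continuous) (fun y x => ?_) hT
  change theta y x ∘L V ∈ compactOperators X
  rw [theta_comp h]
  exact theta_mem_compactOperators _ _

end Theta

/-! ### The C*-algebra of adjointable operators -/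

/-- The adjointable operators on `X`, as a subalgebra of the bounded operators. -/
def adjointable (X : HilbertModule A) : Subalgebra ℂ (X →L[ℂ] X) where
  carrier := {T | ∃ T', IsAdjointPair T T'}
  mul_mem' := by
    rintro S T ⟨S', hS⟩ ⟨T', hT⟩
    exact ⟨_, hS.comp hT⟩
  add_mem' := by
    rintro S T ⟨S', hS⟩ ⟨T', hT⟩
    exact ⟨_, hS.add hT⟩
  algebraMap_mem' r := ⟨star r • ContinuousLinearMap.id ℂ X, fun x y => by
    simp [Algebra.algebraMap_eq_smul_one, CStarModule.inner_smul_left_complex,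
      CStarModule.inner_smul_right_complex]⟩

namespace adjointable

variable {X : HilbertModule A}

theorem isClosed : IsClosed (adjointable X : Set (X →L[ℂ] X)) := by
  refine isClosed_of_closure_subset fun T hT => ?_
  obtain ⟨F, hF, hlim⟩ := mem_closure_iff_seq_limit.mp hT
  choose F' hF' using hF
  obtain ⟨S, S', h, hS, -⟩ := IsAdjointPair.exists_tendsto hF' hlim.cauchySeq
  exact tendsto_nhds_unique hS hlim ▸ ⟨S', h⟩

instance : CompleteSpace (adjointable X) := isClosed.completeSpace_coe

/-- The star operation takes an operator to its (unique) adjoint. -/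
noncomputable instance : Star (adjointable X) :=
  ⟨fun T => ⟨T.2.choose, T, T.2.choose_spec.symm⟩⟩

theorem isAdjointPair_star (T : adjointable X) :
    IsAdjointPair (T : X →L[ℂ] X) (star T : adjointable X) := T.2.choose_spec

theorem star_eq {S T : adjointable X} (h : IsAdjointPair (S : X →L[ℂ] X) T) : star S = T :=
  Subtype.ext ((isAdjointPair_star S).unique h)

noncomputable instance : StarRing (adjointable X) where
  star_involutive T := star_eq (isAdjointPair_star T).symm
  star_mul S T := star_eq ((isAdjointPair_star S).comp (isAdjointPair_star T))
  star_add S T := star_eq ((isAdjointPair_star S).add (isAdjointPair_star T))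

instance : StarModule ℂ (adjointable X) where
  star_smul c T := star_eq ((isAdjointPair_star T).smul c)

instance : CStarRing (adjointable X) where
  norm_mul_self_le T := by
    change ‖(T : X →L[ℂ] X)‖ * ‖(T : X →L[ℂ] X)‖ ≤ ‖((star T * T : adjointable X) : X →L[ℂ] X)‖
    rw [← sq]
    refine (Real.le_sqrt (norm_nonneg _) (norm_nonneg _)).mp
      (ContinuousLinearMap.opNorm_le_bound _ (Real.sqrt_nonneg _) fun x => ?_)
    refine abs_le_of_sq_le_sq' ?_ (by positivity) |>.2
    rw [mul_pow, Real.sq_sqrt (norm_nonneg _), CStarModule.norm_sq_eq Aᵐᵒᵖ, isAdjointPair_star]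
    calc _ ≤ ‖x‖ * ‖((star T * T : adjointable X) : X →L[ℂ] X) x‖ := CStarModule.norm_inner_le X
      _ ≤ ‖x‖ * (‖((star T * T : adjointable X) : X →L[ℂ] X)‖ * ‖x‖) := by
        gcongr; exact ContinuousLinearMap.le_opNorm _ _
      _ = _ := by ring

noncomputable instance : CStarAlgebra (adjointable X) where

/-- The order of the C*-algebra of adjointable operators: `0 ≤ T` if `T = S* S` for some `S`. -/
noncomputable instance : PartialOrder (adjointable X) := CStarAlgebra.spectralOrder _

instance : StarOrderedRing (adjointable X) := CStarAlgebra.spectralOrderedRing _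

theorem norm_coe (T : adjointable X) : ‖(T : X →L[ℂ] X)‖ = ‖T‖ := rfl

@[simp]
theorem coe_mul_apply (S T : adjointable X) (x : X) :
    ((S * T : adjointable X) : X →L[ℂ] X) x = (S : X →L[ℂ] X) ((T : X →L[ℂ] X) x) := rfl

theorem isSelfAdjoint_iff {T : adjointable X} :
    IsSelfAdjoint T ↔ IsAdjointPair (T : X →L[ℂ] X) (T : X →L[ℂ] X) :=
  ⟨fun h => by simpa only [h.star_eq] using isAdjointPair_star T, fun h => star_eq h⟩

/-- A self-adjoint operator whose quadratic form is positive is positive. -/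
theorem nonneg_of_inner_nonneg {T : adjointable X} (hT : IsSelfAdjoint T)
    (h : ∀ x : X, 0 ≤ (inner Aᵐᵒᵖ x ((T : X →L[ℂ] X) x) : Aᵐᵒᵖ)) : 0 ≤ T := by
  -- `s ^ 2` is the negative part of `T`, and `R * T * R = - (s ^ 3) ^ 2` for `R = s ^ 2`
  set R : adjointable X := T⁻ with hR
  have hR0 : 0 ≤ R := CFC.negPart_nonneg T
  obtain ⟨s, hs, hsR⟩ : ∃ s : adjointable X, 0 ≤ s ∧ s * s = R :=
    ⟨CFC.sqrt R, CFC.sqrt_nonneg R, CFC.sqrt_mul_sqrt_self R hR0⟩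
  have hssa := hs.isSelfAdjoint
  have hTR : T * R = - (R * R) := by
    conv_lhs => rw [← CFC.posPart_sub_negPart T hT, sub_mul, CFC.posPart_mul_negPart, zero_sub]
  have key : R * T * R = - (star (s * s * s) * (s * s * s)) := by
    rw [mul_assoc, hTR, ← hsR]
    simp only [star_mul, hssa.star_eq]
    noncomm_ring
  have h0 : s * s * s = 0 := by
    ext x
    change _ = (0 : X)
    rw [← CStarModule.inner_self (A := Aᵐᵒᵖ)]
    refine le_antisymm ?_ CStarModule.inner_self_nonneg
    have := h ((R : X →L[ℂ] X) x)
    rw [isSelfAdjoint_iff.mp hR0.isSelfAdjoint, ← coe_mul_apply, ← coe_mul_apply, key]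
      at this
    have e : (inner Aᵐᵒᵖ x (((-(star (s * s * s) * (s * s * s)) : adjointable X) : X →L[ℂ] X) x) :
        Aᵐᵒᵖ) = - inner Aᵐᵒᵖ (((s * s * s : adjointable X) : X →L[ℂ] X) x)
          (((s * s * s : adjointable X) : X →L[ℂ] X) x) := by
      rw [isAdjointPair_star, ← coe_mul_apply, ← CStarModule.inner_neg_right]
      rfl
    rw [e] at this
    simpa using this
  have hRR : star R * R = 0 := by
    rw [hR0.isSelfAdjoint.star_eq, ← hsR]
    calc s * s * (s * s) = s * s * s * s := by noncomm_ring
      _ = 0 := by rw [h0, zero_mul]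
  have : R = 0 := CStarRing.star_mul_self_eq_zero_iff R |>.mp hRR
  exact (CFC.negPart_eq_zero_iff T hT).mp this

theorem theta_mem (y x : X) : theta y x ∈ adjointable X := ⟨_, isAdjointPair_theta y x⟩

theorem theta_self_nonneg (x : X) : (0 : adjointable X) ≤ ⟨theta x x, theta_mem x x⟩ :=
  nonneg_of_inner_nonneg (isSelfAdjoint_iff.mpr (isAdjointPair_theta x x)) fun z => by
    have : (inner Aᵐᵒᵖ z (theta x x z) : Aᵐᵒᵖ) = star (inner Aᵐᵒᵖ z x) * inner Aᵐᵒᵖ z x := by simp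
    exact this ▸ star_mul_self_nonneg _

end adjointable

/-! ### Factorization in C*-algebras -/

section Factorization

variable {B : Type*} [CStarAlgebra B] [PartialOrder B] [StarOrderedRing B]

/-- If `m` dominates `δ p ^ 2`, then the norm of `p k(m) p` is controlled by the values of `t k(t)`:
with `q = k(m) ^ (1/2)` it is the norm of `q p ^ 2 q ≤ δ⁻¹ q m q`. -/
theorem norm_conj_cfc_le {p m : B} (hp : IsSelfAdjoint p) {δ : ℝ} (hδ : 0 < δ) (hm : 0 ≤ m)
    (h : δ • (p * p) ≤ m) {k : ℝ → ℝ} (hk : Continuous k) {c : ℝ} (hc : 0 ≤ c)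
    (hk0 : ∀ t, 0 ≤ t → 0 ≤ k t) (hkc : ∀ t, 0 ≤ t → t * k t ≤ c) :
    ‖p * cfc k m * p‖ ≤ c / δ := by
  set q := cfc (fun t => √(k t)) m with hq
  have hqsa : IsSelfAdjoint q := cfc_predicate _ _
  have hqc : ContinuousOn (fun t => √(k t)) (spectrum ℝ m) := by fun_prop
  have hspec : ∀ t ∈ spectrum ℝ m, 0 ≤ t := fun t ht => spectrum_nonneg_of_nonneg hm ht
  have hqq : q * q = cfc k m := by
    rw [hq, ← cfc_mul _ _ m hqc hqc]
    exact cfc_congr fun t ht => Real.mul_self_sqrt (hk0 t (hspec t ht))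
  have hqmq : q * m * q = cfc (fun t => t * k t) m := by
    conv_lhs => rw [← cfc_id' ℝ m]
    rw [hq, ← cfc_mul _ _ m hqc, ← cfc_mul _ _ m]
    exact cfc_congr fun t ht => by
      have := Real.mul_self_sqrt (hk0 t (hspec t ht))
      linear_combination t * this
  calc ‖p * cfc k m * p‖ = ‖star (q * p) * (q * p)‖ := by
        rw [← hqq, star_mul, hp.star_eq, hqsa.star_eq]; simp only [mul_assoc]
    _ = ‖(q * p) * star (q * p)‖ := by
        rw [CStarRing.norm_star_mul_self, CStarRing.norm_self_mul_star]
    _ = ‖q * (p * p) * q‖ := by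
        rw [star_mul, hp.star_eq, hqsa.star_eq]; simp only [mul_assoc]
    _ ≤ ‖δ⁻¹ • (q * m * q)‖ := by
        refine CStarAlgebra.norm_le_norm_of_nonneg_of_le
          (hqsa.conjugate_nonneg hp.mul_self_nonneg) ?_
        have := smul_le_smul_of_nonneg_left (hqsa.conjugate_le_conjugate h) (inv_nonneg.mpr hδ.le)
        simpa [mul_smul_comm, smul_mul_assoc, smul_smul, inv_mul_cancel₀ hδ.ne'] using this
    _ ≤ c / δ := by
        rw [hqmq, norm_smul, Real.norm_of_nonneg (inv_nonneg.mpr hδ.le), div_eq_inv_mul]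
        gcongr
        refine norm_cfc_le hc fun t ht => ?_
        have ht := hspec t ht
        rw [Real.norm_of_nonneg (mul_nonneg ht (hk0 t ht))]
        exact hkc t ht

/-- A continuous approximation of `t ↦ t ^ (-1/2)`. -/
noncomputable def rsqrtApprox (s t : ℝ) : ℝ := (√(max t s))⁻¹

theorem continuous_rsqrtApprox {s : ℝ} (hs : 0 < s) : Continuous (rsqrtApprox s) := by
  refine Continuous.inv₀ (by fun_prop) fun t => ?_
  have : 0 < max t s := lt_max_of_lt_right hs
  positivity

theorem mul_rsqrtApprox_sq {s t : ℝ} (hs : 0 < s) (ht : 0 ≤ t) :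
    0 ≤ 1 - t * rsqrtApprox s t ^ 2 ∧ t * (1 - t * rsqrtApprox s t ^ 2) ≤ s := by
  have hm : 0 < max t s := lt_max_of_lt_right hs
  have e : t * rsqrtApprox s t ^ 2 = t / max t s := by
    rw [rsqrtApprox, inv_pow, Real.sq_sqrt hm.le, div_eq_mul_inv]
  rw [e]
  have h1 : t / max t s ≤ 1 := div_le_one_of_le₀ (le_max_left _ _) hm.le
  have h0 : 0 ≤ t / max t s := by positivity
  refine ⟨by linarith, ?_⟩
  rcases le_total s t with hst | hst
  · rcases eq_or_ne t 0 with rfl | h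
    · simp [hs.le]
    · rw [max_eq_left hst, div_self h]; simp [hs.le]
  · nlinarith

theorem mul_rsqrtApprox_sub_sq_le {s s' t : ℝ} (hs : 0 < s) (hs' : 0 < s') (ht : 0 ≤ t) :
    t * (t * (rsqrtApprox s t - rsqrtApprox s' t) ^ 2) ≤ s + s' := by
  obtain ⟨h1, h2⟩ := mul_rsqrtApprox_sq hs ht
  obtain ⟨h1', h2'⟩ := mul_rsqrtApprox_sq hs' ht
  have hr : 0 ≤ rsqrtApprox s t := by unfold rsqrtApprox; positivity
  have hr' : 0 ≤ rsqrtApprox s' t := by unfold rsqrtApprox; positivity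
  generalize rsqrtApprox s t = x at *
  generalize rsqrtApprox s' t = y at *
  -- with `u = √t x` and `v = √t y` in `[0, 1]` this is `(u - v) ^ 2 ≤ (1 - u ^ 2) + (1 - v ^ 2)`
  have key : t * (x - y) ^ 2 ≤ (1 - t * x ^ 2) + (1 - t * y ^ 2) := by
    rcases le_total x y with h | h
    · nlinarith [mul_nonneg ht (mul_nonneg hr (sub_nonneg.mpr h))]
    · nlinarith [mul_nonneg ht (mul_nonneg hr' (sub_nonneg.mpr h))]
  nlinarith [mul_le_mul_of_nonneg_left key ht]

/-- If `p b p` dominates a multiple of `p ^ 2`, then `p ^ 2` is a limit of elements `d b d`, where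
`d` runs over a sequence that is Cauchy for the seminorm `d ↦ ‖d b d‖ ^ (1/2)`: take
`d = p (p b p) ^ (-1/2) p`, with the inverse square root approximated by continuous functions. -/
theorem exists_seq_conj_tendsto {b p : B} (hb : 0 ≤ b) (hp : IsSelfAdjoint p) {δ : ℝ} (hδ : 0 < δ)
    (h : δ • (p * p) ≤ p * b * p) :
    ∃ d : ℕ → B, (∀ n, IsSelfAdjoint (d n)) ∧
      Tendsto (fun n => d n * b * d n) atTop (𝓝 (p * p)) ∧
      ∀ ε > 0, ∃ N, ∀ i ≥ N, ∀ j ≥ N, ‖(d i - d j) * b * (d i - d j)‖ < ε := by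
  set m := p * b * p with hm
  have hm0 : 0 ≤ m := hp.conjugate_nonneg hb
  let s : ℕ → ℝ := fun n => 1 / ((n : ℝ) + 1)
  have hs : ∀ n, 0 < s n := fun n => by positivity
  have hs0 : Tendsto s atTop (𝓝 0) := tendsto_one_div_add_atTop_nhds_zero_nat
  have hrc := fun n => continuous_rsqrtApprox (hs n)
  have conj : ∀ ρ : ℝ → ℝ, Continuous ρ →
      (p * cfc ρ m * p) * b * (p * cfc ρ m * p) = p * cfc (fun t => t * ρ t ^ 2) m * p := by
    intro ρ hρ
    have : cfc (fun t => t * ρ t ^ 2) m = cfc ρ m * m * cfc ρ m := by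
      conv_rhs => enter [1, 2]; rw [← cfc_id' ℝ m]
      rw [← cfc_mul _ _ m, ← cfc_mul _ _ m]
      congr 1; ext t; ring
    rw [this]
    conv_rhs => enter [1, 2, 1, 2]; rw [hm]
    simp only [mul_assoc]
  refine ⟨fun n => p * cfc (rsqrtApprox (s n)) m * p, fun n => ?_, ?_, ?_⟩
  · have : IsSelfAdjoint (cfc (rsqrtApprox (s n)) m) := cfc_predicate _ _
    exact this.conjugate_self hp
  · rw [tendsto_iff_norm_sub_tendsto_zero]
    refine squeeze_zero (fun _ => norm_nonneg _) (fun n => ?_)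
      (by simpa using hs0.div_const δ)
    have hc := hrc n
    have e : p * cfc (rsqrtApprox (s n)) m * p * b * (p * cfc (rsqrtApprox (s n)) m * p) - p * p =
        - (p * cfc (fun t => 1 - t * rsqrtApprox (s n) t ^ 2) m * p) := by
      rw [conj _ hc, cfc_sub _ _ m, cfc_const_one ℝ m]
      noncomm_ring
    rw [e, norm_neg]
    exact norm_conj_cfc_le hp hδ hm0 h (by fun_prop) (hs n).le
      (fun t ht => (mul_rsqrtApprox_sq (hs n) ht).1) (fun t ht => (mul_rsqrtApprox_sq (hs n) ht).2)
  · intro ε hε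
    obtain ⟨N, hN⟩ := eventually_atTop.mp
      (hs0.eventually_lt_const (show (0 : ℝ) < ε * δ / 2 by positivity))
    refine ⟨N, fun i hi j hj => ?_⟩
    have hi' := hrc i
    have hj' := hrc j
    have e : p * cfc (rsqrtApprox (s i)) m * p - p * cfc (rsqrtApprox (s j)) m * p =
        p * cfc (fun t => rsqrtApprox (s i) t - rsqrtApprox (s j) t) m * p := by
      rw [cfc_sub _ _ m]; noncomm_ring
    simp only [e]
    rw [conj _ (by fun_prop)]
    calc _ ≤ (s i + s j) / δ :=
          norm_conj_cfc_le hp hδ hm0 h (by fun_prop) (add_pos (hs i) (hs j)).le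
            (fun t ht => by positivity) (fun t ht => mul_rsqrtApprox_sub_sq_le (hs i) (hs j) ht)
      _ < ε := by
          rw [div_lt_iff₀ hδ]
          linarith [hN i hi, hN j hj]

/-- If `b` is close to `T ^ 2`, then `b` is bounded below on the part of the spectrum of `T` that
carries the function `max 0 (2 t - 1)`. -/
theorem smul_bump_sq_le {T b : B} (hT : IsSelfAdjoint T) (hbsa : IsSelfAdjoint b)
    (hST : ‖b - T * T‖ ≤ 1 / 8) :
    (1 / 8 : ℝ) •
        (cfc (fun t : ℝ => max 0 (2 * t - 1)) T * cfc (fun t : ℝ => max 0 (2 * t - 1)) T) ≤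
      cfc (fun t : ℝ => max 0 (2 * t - 1)) T * b * cfc (fun t : ℝ => max 0 (2 * t - 1)) T := by
  set f : ℝ → ℝ := fun t => max 0 (2 * t - 1) with hf
  have hfc : Continuous f := by fun_prop
  set p : B := cfc f T with hp
  have hpsa : IsSelfAdjoint p := cfc_predicate _ _
  have h1 : (1 / 4 : ℝ) • (p * p) ≤ p * (T * T) * p := by
    have e1 : (1 / 4 : ℝ) • (p * p) = cfc (fun t => (1 / 4 : ℝ) • (f t * f t)) T := by
      rw [cfc_smul _ _ T, cfc_mul _ _ T]
    have e2 : p * (T * T) * p = cfc (fun t => f t * (t * t) * f t) T := by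
      rw [cfc_mul _ _ T, cfc_mul _ _ T, cfc_mul _ _ T, cfc_id' ℝ T]
    rw [e1, e2]
    refine cfc_mono fun t _ => ?_
    rcases le_total t (1 / 2) with h | h
    · simp [hf, max_eq_left (show 2 * t - 1 ≤ 0 by linarith)]
    · have : 1 / 4 ≤ t * t := by nlinarith
      simp only [smul_eq_mul]
      nlinarith [mul_le_mul_of_nonneg_right this (mul_self_nonneg (f t))]
  have h2 : T * T - (1 / 8 : ℝ) • 1 ≤ b := by
    have hsa : IsSelfAdjoint (b - T * T) := hbsa.sub (hT.mul_self_nonneg.isSelfAdjoint)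
    have h3 := hsa.neg_algebraMap_norm_le_self
    have h4 : algebraMap ℝ (B) ‖b - T * T‖ ≤ algebraMap ℝ (B) (1 / 8) :=
      algebraMap_mono _ hST
    rw [Algebra.algebraMap_eq_smul_one (1 / 8 : ℝ)] at h4
    have := (neg_le_neg h4).trans h3
    rw [sub_eq_add_neg]
    calc T * T + -((1 / 8 : ℝ) • 1) ≤ T * T + (b - T * T) := by gcongr
      _ = b := by abel
  have := hpsa.conjugate_le_conjugate h2
  rw [mul_sub, sub_mul, mul_smul_comm, mul_one, smul_mul_assoc] at this
  calc (1 / 8 : ℝ) • (p * p) = (1 / 4 : ℝ) • (p * p) - (1 / 8 : ℝ) • (p * p) := by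
        rw [← sub_smul]; norm_num
    _ ≤ p * (T * T) * p - (1 / 8 : ℝ) • (p * p) := by gcongr
    _ ≤ _ := this

end Factorization

/-! ### Perturbation of operators that fix a submodule -/

section Perturbation

variable {Y Z : HilbertModule A}

/-- The function `max 0 (2 t - 1)` of `T`, written as `1 + (t - 1) g(t)` to make it plain that it
fixes the vectors fixed by `T`. -/
theorem cfc_bump_apply {T : adjointable Z} (hT : IsSelfAdjoint T) {z : Z}
    (hz : (T : Z →L[ℂ] Z) z = z) :
    ((cfc (fun t : ℝ => max 0 (2 * t - 1)) T : adjointable Z) : Z →L[ℂ] Z) z = z := by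
  have hg : Continuous fun t : ℝ => (max (1 / 2) (1 - t))⁻¹ :=
    Continuous.inv₀ (by fun_prop) fun t => by
      have : (0 : ℝ) < max (1 / 2) (1 - t) := lt_max_of_lt_left (by norm_num)
      exact this.ne'
  have e : (fun t : ℝ => max 0 (2 * t - 1)) =
      fun t : ℝ => 1 + (max (1 / 2) (1 - t))⁻¹ * (t - 1) := by
    ext t
    rcases le_total t (1 / 2) with h | h
    · rw [max_eq_left (by linarith), max_eq_right (by linarith)]
      have : 1 - t ≠ 0 := by linarith
      field_simp
      ring
    · rw [max_eq_right (by linarith), max_eq_left (by linarith)]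
      ring
  rw [e, cfc_add T (fun _ => (1 : ℝ)) (fun t => (max (1 / 2) (1 - t))⁻¹ * (t - 1))
      continuousOn_const (hg.continuousOn.mul (by fun_prop)),
    cfc_mul (fun t : ℝ => (max (1 / 2) (1 - t))⁻¹) (fun t => t - 1) T hg.continuousOn,
    cfc_sub _ _ T, cfc_const_one ℝ T, cfc_id' ℝ T]
  have : ((T - 1 : adjointable Z) : Z →L[ℂ] Z) z = 0 := by
    change (T : Z →L[ℂ] Z) z - z = 0
    rw [hz, sub_self]
  change z + ((cfc _ T * (T - 1) : adjointable Z) : Z →L[ℂ] Z) z = z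
  rw [adjointable.coe_mul_apply, this, map_zero, add_zero]

theorem tendsto_clm_comp {E F G ι : Type*} [NormedAddCommGroup E] [NormedSpace ℂ E]
    [NormedAddCommGroup F] [NormedSpace ℂ F] [NormedAddCommGroup G] [NormedSpace ℂ G]
    {l : Filter ι} {f : ι → F →L[ℂ] G} {g : ι → E →L[ℂ] F} {f₀ : F →L[ℂ] G} {g₀ : E →L[ℂ] F}
    (hf : Tendsto f l (𝓝 f₀)) (hg : Tendsto g l (𝓝 g₀)) :
    Tendsto (fun i => f i ∘L g i) l (𝓝 (f₀ ∘L g₀)) :=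
  ((ContinuousLinearMap.compL ℂ E F G).continuous₂.tendsto (f₀, g₀)).comp (hf.prodMk_nhds hg)

theorem norm_comp_le_sqrt {S : Z →L[ℂ] Y} {S' : Y →L[ℂ] Z} (hS : IsAdjointPair S S')
    {b e : adjointable Z} (hb : (b : Z →L[ℂ] Z) = S' ∘L S) (he : IsSelfAdjoint e) :
    ‖S ∘L (e : Z →L[ℂ] Z)‖ ≤ √‖e * b * e‖ := by
  refine ContinuousLinearMap.opNorm_le_bound _ (Real.sqrt_nonneg _) fun x => ?_
  refine abs_le_of_sq_le_sq' ?_ (by positivity) |>.2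
  have key : (inner Aᵐᵒᵖ (S ((e : Z →L[ℂ] Z) x)) (S ((e : Z →L[ℂ] Z) x)) : Aᵐᵒᵖ) =
      inner Aᵐᵒᵖ x (((e * b * e : adjointable Z) : Z →L[ℂ] Z) x) := by
    rw [hS, adjointable.isSelfAdjoint_iff.mp he, adjointable.coe_mul_apply,
      adjointable.coe_mul_apply, hb]
    rfl
  rw [mul_pow, Real.sq_sqrt (norm_nonneg _), CStarModule.norm_sq_eq Aᵐᵒᵖ,
    ContinuousLinearMap.comp_apply, key]
  calc _ ≤ ‖x‖ * ‖((e * b * e : adjointable Z) : Z →L[ℂ] Z) x‖ := CStarModule.norm_inner_le Z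
    _ ≤ ‖x‖ * (‖((e * b * e : adjointable Z) : Z →L[ℂ] Z)‖ * ‖x‖) := by
      gcongr; exact ContinuousLinearMap.le_opNorm _ _
    _ = _ := by rw [adjointable.norm_coe]; ring

/-- If `S* S` is close to `T ^ 2`, with `T` self-adjoint, then on the fixed vectors of `T` the map
`S` can be corrected to an adjointable isometry into the codomain of `S`. -/
theorem exists_isometric_on_fixed {T : adjointable Z} (hT : IsSelfAdjoint T) {S : Z →L[ℂ] Y}
    {S' : Y →L[ℂ] Z} (hS : IsAdjointPair S S')
    (hST : ‖S' ∘L S - ((T * T : adjointable Z) : Z →L[ℂ] Z)‖ ≤ 1 / 8) :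
    ∃ V V', IsAdjointPair (X := Z) (Y := Y) V V' ∧
      ∀ z, (T : Z →L[ℂ] Z) z = z → V' (V z) = z := by
  let b : adjointable Z := ⟨S' ∘L S, _, hS.symm.comp hS⟩
  have hbsa : IsSelfAdjoint b := adjointable.isSelfAdjoint_iff.mpr (hS.symm.comp hS)
  have hb : 0 ≤ b := adjointable.nonneg_of_inner_nonneg hbsa fun x => by
    change 0 ≤ (inner Aᵐᵒᵖ x (S' (S x)) : Aᵐᵒᵖ)
    rw [← hS]
    exact CStarModule.inner_self_nonneg
  set p : adjointable Z := cfc (fun t : ℝ => max 0 (2 * t - 1)) T with hp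
  have hpsa : IsSelfAdjoint p := cfc_predicate _ _
  have h5 : (1 / 8 : ℝ) • (p * p) ≤ p * b * p := smul_bump_sq_le hT hbsa hST
  obtain ⟨d, hd, hlim, hcau⟩ := exists_seq_conj_tendsto hb hpsa (by norm_num) h5
  have hpair : ∀ e : adjointable Z, IsSelfAdjoint e →
      IsAdjointPair (S ∘L (e : Z →L[ℂ] Z)) ((e : Z →L[ℂ] Z) ∘L S') := fun e he =>
    hS.comp (adjointable.isSelfAdjoint_iff.mp he)
  have hcs : CauchySeq fun n => S ∘L (d n : Z →L[ℂ] Z) := by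
    refine Metric.cauchySeq_iff.mpr fun ε hε => ?_
    obtain ⟨N, hN⟩ := hcau (ε ^ 2) (by positivity)
    refine ⟨N, fun i hi j hj => ?_⟩
    have e : S ∘L (d i : Z →L[ℂ] Z) - S ∘L (d j : Z →L[ℂ] Z) =
        S ∘L ((d i - d j : adjointable Z) : Z →L[ℂ] Z) := by
      ext x; simp
    rw [dist_eq_norm, e]
    have hsub : IsSelfAdjoint (d i - d j) := (hd i).sub (hd j)
    refine (norm_comp_le_sqrt hS (b := b) rfl hsub).trans_lt ?_
    rw [Real.sqrt_lt' hε]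
    exact hN i hi j hj
  obtain ⟨V, V', hV, hlV, hlV'⟩ := IsAdjointPair.exists_tendsto (fun n => hpair (d n) (hd n)) hcs
  refine ⟨V, V', hV, fun z hz => ?_⟩
  have hVV : V' ∘L V = ((p * p : adjointable Z) : Z →L[ℂ] Z) := by
    have hl1 : Tendsto (fun n => ((d n : Z →L[ℂ] Z) ∘L S') ∘L (S ∘L (d n : Z →L[ℂ] Z))) atTop
        (𝓝 (V' ∘L V)) :=
      tendsto_clm_comp hlV' hlV
    have hl2 := continuous_subtype_val.continuousAt.tendsto.comp hlim
    exact tendsto_nhds_unique hl1 hl2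
  have hpz : (p : Z →L[ℂ] Z) z = z := cfc_bump_apply hT hz
  change (V' ∘L V) z = z
  rw [hVV, adjointable.coe_mul_apply, hpz, hpz]

end Perturbation

/-! ### Embeddings and compact embeddings of Hilbert modules -/

/-- A (not necessarily adjointable) embedding of Hilbert modules: a linear map that preserves the
inner product. It is automatically `A`-linear and isometric. -/
def IsEmbedding {X Y : HilbertModule A} (i : X →L[ℂ] Y) : Prop :=
  ∀ x y, (inner Aᵐᵒᵖ (i x) (i y) : Aᵐᵒᵖ) = inner Aᵐᵒᵖ x y

namespace IsEmbedding

variable {X Y Z : HilbertModule A} {i : X →L[ℂ] Y}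

theorem norm_map (h : IsEmbedding i) (x : X) : ‖i x‖ = ‖x‖ := by
  rw [CStarModule.norm_eq_sqrt_norm_inner_self (A := Aᵐᵒᵖ), h,
    ← CStarModule.norm_eq_sqrt_norm_inner_self (A := Aᵐᵒᵖ)]

theorem isometry (h : IsEmbedding i) : Isometry i :=
  AddMonoidHomClass.isometry_of_norm i h.norm_map

theorem map_smul (h : IsEmbedding i) (a : Aᵐᵒᵖ) (x : X) : i (a • x) = a • i x := by
  rw [← sub_eq_zero, ← CStarModule.inner_self (A := Aᵐᵒᵖ)]
  simp only [CStarModule.inner_sub_left, CStarModule.inner_sub_right, h _ _,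
    CStarModule.inner_op_smul_left, CStarModule.inner_op_smul_right, mul_assoc, sub_self,
    mul_zero]

theorem isClosed_range (h : IsEmbedding i) : IsClosed (Set.range i) :=
  h.isometry.isClosedEmbedding.isClosed_range

theorem comp {j : Y →L[ℂ] Z} (hj : IsEmbedding j) (h : IsEmbedding i) : IsEmbedding (j ∘L i) :=
  fun x y => (hj _ _).trans (h x y)

end IsEmbedding

/-- A linear map that preserves the inner product, made into a continuous linear map. -/
theorem exists_isEmbedding_of_inner {X Y : HilbertModule A} (f : X →ₗ[ℂ] Y)
    (hf : ∀ x y, (inner Aᵐᵒᵖ (f x) (f y) : Aᵐᵒᵖ) = inner Aᵐᵒᵖ x y) :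
    ∃ i : X →L[ℂ] Y, IsEmbedding i ∧ ∀ x, i x = f x :=
  ⟨f.mkContinuous 1 fun x => by
    rw [CStarModule.norm_eq_sqrt_norm_inner_self (A := Aᵐᵒᵖ), hf,
      ← CStarModule.norm_eq_sqrt_norm_inner_self (A := Aᵐᵒᵖ), one_mul], hf, fun _ => rfl⟩

theorem exists_isEmbedding_of_range_subset {X Y Z : HilbertModule A} {i : X →L[ℂ] Z}
    {j : Y →L[ℂ] Z} (hi : IsEmbedding i) (hj : IsEmbedding j) (h : Set.range i ⊆ Set.range j) :
    ∃ k : X →L[ℂ] Y, IsEmbedding k := by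
  let e := LinearEquiv.ofInjective j.toLinearMap hj.isometry.injective
  have hje : ∀ z, j (e.symm z) = z := fun z => congrArg Subtype.val (e.apply_symm_apply z)
  let f : X →ₗ[ℂ] Y := e.symm.toLinearMap ∘ₗ i.toLinearMap.codRestrict _ fun x => h ⟨x, rfl⟩
  have hf : ∀ x, j (f x) = i x := fun x => hje _
  obtain ⟨k, hk, -⟩ := exists_isEmbedding_of_inner f fun x y => by rw [← hj, hf, hf, hi]
  exact ⟨k, hk⟩

/-- `W` is isomorphic to a compactly contained submodule of `X`. -/
def CompactlyEmbeds (W X : HilbertModule A) : Prop :=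
  ∃ i : W →L[ℂ] X, IsEmbedding i ∧ ∃ T ∈ compactOperators X, IsAdjointPair T T ∧
    ∀ w, T (i w) = i w

/-- Compact embeddings are, up to isomorphism, compactly contained submodules: the range of an
embedding is closed, being isometric to a complete module. -/
theorem compactlyEmbeds_iff {W X : HilbertModule A} :
    CompactlyEmbeds W X ↔ ∃ X₀ : HilbertSubmodule X, CompactlyContained X₀ ∧
      Nonempty (Iso W X₀.toHilbertModule) := by
  constructor
  · rintro ⟨i, hi, T, hT, hTT, hTi⟩
    let X₀ : HilbertSubmodule X :=
      { toSubmodule := LinearMap.range i.toLinearMap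
        smul_mem_right := by
          rintro a _ ⟨w, rfl⟩
          exact ⟨a • w, hi.map_smul a w⟩
        isClosed := hi.isClosed_range }
    refine ⟨X₀, ⟨T, hT, hTT, ?_⟩, ⟨⟨LinearEquiv.ofInjective i.toLinearMap hi.isometry.injective,
      fun a w => Subtype.ext (hi.map_smul a w), fun x y => hi x y⟩⟩⟩
    rintro _ ⟨w, rfl⟩
    exact hTi w
  · rintro ⟨X₀, ⟨T, hT, hTT, hTX⟩, ⟨e⟩⟩
    obtain ⟨i, hi, hie⟩ := exists_isEmbedding_of_inner (X := W) (Y := X)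
      (X₀.toSubmodule.subtype ∘ₗ e.toLinearEquiv.toLinearMap) (fun x y => e.map_inner x y)
    refine ⟨i, hi, T, hT, hTT, fun w => hTX _ ?_⟩
    rw [hie]
    exact (e.toLinearEquiv w).2

theorem norm_le_of_norm_inner_le {X Y : HilbertModule A} {R : X →L[ℂ] Y} {c : ℝ} (hc : 0 ≤ c)
    (h : ∀ x y, ‖(inner Aᵐᵒᵖ y (R x) : Aᵐᵒᵖ)‖ ≤ c * ‖y‖ * ‖x‖) : ‖R‖ ≤ c := by
  refine R.opNorm_le_bound hc fun x => ?_
  rcases (norm_nonneg (R x)).eq_or_lt with h0 | h0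
  · rw [← h0]; positivity
  refine le_of_mul_le_mul_left ?_ h0
  calc ‖R x‖ * ‖R x‖ = ‖(inner Aᵐᵒᵖ (R x) (R x) : Aᵐᵒᵖ)‖ := by
        rw [← CStarModule.norm_sq_eq Aᵐᵒᵖ, sq]
    _ ≤ c * ‖R x‖ * ‖x‖ := h x (R x)
    _ = _ := by ring

section Extension

variable {X Y : HilbertModule A} {k : X →L[ℂ] Y}

/-- If `R'` extends `R` along an embedding and the adjoint of `R'` maps into the range of the
embedding, then the norm of `R'` is at most that of `R`. -/
theorem norm_le_of_extends (hk : IsEmbedding k) {R : X →L[ℂ] X} {R' Q : Y →L[ℂ] Y}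
    (hR : ∀ x, R' (k x) = k (R x)) (hQ : IsAdjointPair R' Q) (hQk : ∀ y, Q y ∈ Set.range k) :
    ‖R'‖ ≤ ‖R‖ := by
  rw [← hQ.norm_eq]
  refine norm_le_of_norm_inner_le (norm_nonneg _) fun x y => ?_
  obtain ⟨w, hw⟩ := hQk x
  -- it suffices to bound `‖Q x‖`, where `‖Q x‖ ^ 2 = ‖⟨R' (Q x), x⟩‖` and `R' (Q x) = k (R w)`
  suffices hQx : ‖Q x‖ ≤ ‖R‖ * ‖x‖ by
    calc _ ≤ ‖y‖ * ‖Q x‖ := CStarModule.norm_inner_le Y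
      _ ≤ ‖y‖ * (‖R‖ * ‖x‖) := by gcongr
      _ = _ := by ring
  rcases (norm_nonneg (Q x)).eq_or_lt with h0 | h0
  · rw [← h0]; positivity
  refine le_of_mul_le_mul_left ?_ h0
  calc ‖Q x‖ * ‖Q x‖ = ‖(inner Aᵐᵒᵖ (R' (Q x)) x : Aᵐᵒᵖ)‖ := by
        rw [hQ, ← CStarModule.norm_sq_eq Aᵐᵒᵖ, sq]
    _ ≤ ‖R' (Q x)‖ * ‖x‖ := CStarModule.norm_inner_le Y
    _ ≤ ‖R‖ * ‖w‖ * ‖x‖ := by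
        rw [← hw, hR, hk.norm_map]; gcongr; exact R.le_opNorm w
    _ = _ := by rw [← hw, hk.norm_map]; ring

/-- The operators on `X` that extend, along `k`, to a compact operator on `Y` whose adjoint maps
into the range of `k`. -/
def extendable (k : X →L[ℂ] Y) : Submodule ℂ (X →L[ℂ] X) where
  carrier := {R | ∃ R' ∈ compactOperators Y, (∀ x, R' (k x) = k (R x)) ∧
    ∃ Q, IsAdjointPair R' Q ∧ ∀ y, Q y ∈ LinearMap.range k.toLinearMap}
  add_mem' := by
    rintro R S ⟨R', hR', hR, Q, hQ, hQk⟩ ⟨S', hS', hS, P, hP, hPk⟩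
    exact ⟨R' + S', add_mem hR' hS', fun x => by simp [hR, hS], Q + P, hQ.add hP,
      fun y => add_mem (hQk y) (hPk y)⟩
  zero_mem' := ⟨0, zero_mem _, fun x => by simp, 0, fun x y => by simp, fun y => zero_mem _⟩
  smul_mem' := by
    rintro c R ⟨R', hR', hR, Q, hQ, hQk⟩
    exact ⟨c • R', Submodule.smul_mem _ c hR', fun x => by simp [hR], star c • Q, hQ.smul c,
      fun y => Submodule.smul_mem _ _ (hQk y)⟩

/-- Extensions are contractive in the operator, so that extensions of a convergent sequence
converge. -/
theorem isClosed_extendable (hk : IsEmbedding k) :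
    IsClosed (extendable k : Set (X →L[ℂ] X)) := by
  refine isClosed_of_closure_subset fun R hR => ?_
  obtain ⟨F, hF, hlim⟩ := mem_closure_iff_seq_limit.mp hR
  choose F' hF' hFk Q hQ hQk using hF
  have hcau : CauchySeq F' := by
    have := Metric.cauchySeq_iff.mp hlim.cauchySeq
    refine Metric.cauchySeq_iff.mpr fun ε hε => ?_
    obtain ⟨N, hN⟩ := this ε hε
    refine ⟨N, fun m hm n hn => lt_of_le_of_lt ?_ (hN m hm n hn)⟩
    rw [dist_eq_norm, dist_eq_norm]
    exact norm_le_of_extends hk (fun x => by simp [hFk]) ((hQ m).sub (hQ n))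
      (fun y => sub_mem (S := Submodule ℂ Y) (hQk m y) (hQk n y))
  obtain ⟨R', P, hRP, hR', hP⟩ := IsAdjointPair.exists_tendsto hQ hcau
  have happ : ∀ {U V : HilbertModule A} {G : ℕ → U →L[ℂ] V} {G₀ : U →L[ℂ] V},
      Tendsto G atTop (𝓝 G₀) → ∀ u, Tendsto (fun n => G n u) atTop (𝓝 (G₀ u)) :=
    fun h u => ((ContinuousLinearMap.apply ℂ _ u).continuous.tendsto _).comp h
  refine ⟨R', isClosed_compactOperators.mem_of_tendsto hR' (Eventually.of_forall hF'),
    fun x => ?_, P, hRP, fun y => ?_⟩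
  · refine tendsto_nhds_unique (happ hR' (k x)) ?_
    simp only [hFk]
    exact (k.continuous.tendsto _).comp (happ hlim x)
  · exact hk.isClosed_range.mem_of_tendsto (happ hP y) (Eventually.of_forall fun n => hQk n y)

theorem compactOperators_le_extendable (hk : IsEmbedding k) : compactOperators X ≤ extendable k :=
  compactOperators_le (isClosed_extendable hk) fun y x =>
    ⟨theta (k y) (k x), theta_mem_compactOperators _ _, fun z => by
      simp [hk _ _, hk.map_smul], theta (k x) (k y), isAdjointPair_theta _ _,
      fun z => ⟨(inner Aᵐᵒᵖ (k y) z : Aᵐᵒᵖ) • x, hk.map_smul _ _⟩⟩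

/-- Compact embeddedness in a submodule implies compact embeddedness in the whole module: compact
operators extend along embeddings. -/
theorem CompactlyEmbeds.comp_right {W : HilbertModule A} (h : CompactlyEmbeds W X)
    (hk : IsEmbedding k) : CompactlyEmbeds W Y := by
  obtain ⟨i, hi, T, hT, hTT, hTi⟩ := h
  obtain ⟨R, hR, hRk, Q, hQ, hQk⟩ := compactOperators_le_extendable hk hT
  -- the extension need not be self-adjoint, so that the product with its adjoint `Q` has to be used instead
  have hQT : ∀ x, Q (k x) = k (T x) := fun x => by
    obtain ⟨w, hw⟩ := hQk (k x)
    have hw' : k w = Q (k x) := hw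
    rw [← hw']
    congr 1
    refine ext_inner Aᵐᵒᵖ fun z => ?_
    rw [← hk, hw', ← hQ, hRk, hk, hTT]
  refine ⟨k ∘L i, hk.comp hi, R ∘L Q, comp_mem_compactOperators hQ.symm hR, ?_, fun w => ?_⟩
  · exact hQ.comp hQ.symm
  · simp [hQT, hRk, hTi]

end Extension

/-! ### Compact embeddings into inductive limits -/

section Exhaustion

variable {Z : HilbertModule A} {V : ℕ → HilbertModule A} {j : ∀ n, V n →L[ℂ] Z}

/-- A compact operator on `Z` is approximated by maps into the members of an increasing sequence of
submodules with dense union. -/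
theorem exists_norm_comp_sub_lt (hj : ∀ n, IsEmbedding (j n))
    (hmono : Monotone fun n => Set.range (j n)) (hd : Dense (⋃ n, Set.range (j n)))
    {T : Z →L[ℂ] Z} (hT : T ∈ compactOperators Z) {ε : ℝ} (hε : 0 < ε) :
    ∃ (n : ℕ) (S : Z →L[ℂ] V n) (S' : V n →L[ℂ] Z), IsAdjointPair S S' ∧ ‖j n ∘L S - T‖ < ε := by
  let F : ℕ → Submodule ℂ (Z →L[ℂ] Z) := fun n =>
    Submodule.span ℂ {R | ∃ (y : V n) (x : Z), R = theta (j n y) x}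
  have hF : Monotone F := fun m n hmn => Submodule.span_mono <| by
    rintro _ ⟨y, x, rfl⟩
    obtain ⟨y', hy'⟩ := hmono hmn ⟨y, rfl⟩
    exact ⟨y', x, by rw [hy']⟩
  have hle : compactOperators Z ≤ (⨆ n, F n).topologicalClosure := by
    refine compactOperators_le (Submodule.isClosed_topologicalClosure _) fun y x => ?_
    have hc : Continuous fun y : Z => (theta y x : Z →L[ℂ] Z) :=
      (LipschitzWith.of_dist_le_mul (K := ‖x‖₊) fun y y' => by
        rw [dist_eq_norm, dist_eq_norm, ← theta_sub_left]
        exact norm_theta_le _ _).continuous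
    refine map_mem_closure (f := fun y : Z => (theta y x : Z →L[ℂ] Z)) hc (hd y) fun w hw => ?_
    obtain ⟨n, v, rfl⟩ := Set.mem_iUnion.mp hw
    exact Submodule.mem_iSup_of_mem n (Submodule.subset_span ⟨v, x, rfl⟩)
  obtain ⟨R, hR, hTR⟩ := Metric.mem_closure_iff.mp (hle hT) ε hε
  obtain ⟨n, hn⟩ := (Submodule.mem_iSup_of_directed F hF.directed_le).mp hR
  have key : ∃ (S : Z →L[ℂ] V n) (S' : V n →L[ℂ] Z), IsAdjointPair S S' ∧ j n ∘L S = R := by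
    refine Submodule.span_induction ?_ ?_ ?_ ?_ hn
    · rintro _ ⟨y, x, rfl⟩
      refine ⟨theta y x, theta x y, isAdjointPair_theta y x, ?_⟩
      ext z
      simp [(hj n).map_smul]
    · exact ⟨0, 0, fun x y => by simp, by simp⟩
    · rintro _ _ - - ⟨S, S', hS, rfl⟩ ⟨T, T', hT, rfl⟩
      exact ⟨S + T, S' + T', hS.add hT, by simp⟩
    · rintro c _ - ⟨S, S', hS, rfl⟩
      exact ⟨c • S, star c • S', hS.smul c, by simp⟩
  obtain ⟨S, S', hS, rfl⟩ := key
  exact ⟨n, S, S', hS, by rwa [← dist_eq_norm, dist_comm]⟩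

/-- A module that embeds compactly in the closure of an increasing union of submodules embeds
compactly in one of them. -/
theorem CompactlyEmbeds.exists_of_dense (hj : ∀ n, IsEmbedding (j n))
    (hmono : Monotone fun n => Set.range (j n)) (hd : Dense (⋃ n, Set.range (j n)))
    {W : HilbertModule A} (h : CompactlyEmbeds W Z) : ∃ n, CompactlyEmbeds W (V n) := by
  obtain ⟨i, hi, T, hT, hTT, hTi⟩ := h
  let T' : adjointable Z := ⟨T, T, hTT⟩
  -- `‖j S - T‖ ≤ ε ≤ 1` gives `‖S* S - T ^ 2‖ ≤ ε (‖T‖ + 1) + ‖T‖ ε`, and the bound is made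
  -- equal to `1 / 8`
  set ε : ℝ := 1 / (8 * (2 * ‖T‖ + 1)) with hε
  have hε0 : 0 < ε := by positivity
  have hε1 : ε * (2 * ‖T‖ + 1) = 1 / 8 := by
    rw [hε]; field_simp
  have hε2 : ε ≤ 1 := by
    rw [hε, div_le_one (by positivity)]; linarith [norm_nonneg T]
  obtain ⟨n, S, S', hS, hST⟩ := exists_norm_comp_sub_lt hj hmono hd hT hε0
  have hjS : ‖j n ∘L S‖ ≤ ‖T‖ + 1 := by
    have := norm_add_le (j n ∘L S - T) T
    rw [sub_add_cancel] at this
    linarith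
  have hclose : ‖S' ∘L S - T ∘L T‖ ≤ 1 / 8 := by
    refine norm_le_of_norm_inner_le (by norm_num) fun x y => ?_
    have e : (inner Aᵐᵒᵖ y ((S' ∘L S - T ∘L T) x) : Aᵐᵒᵖ) =
        inner Aᵐᵒᵖ ((j n ∘L S - T) y) ((j n ∘L S) x) + inner Aᵐᵒᵖ (T y) ((j n ∘L S - T) x) := by
      simp only [sub_apply, ContinuousLinearMap.comp_apply,
        CStarModule.inner_sub_right, CStarModule.inner_sub_left, ← hS y, ← hTT y, hj n _ _]
      abel
    rw [e]
    calc _ ≤ ‖(j n ∘L S - T) y‖ * ‖(j n ∘L S) x‖ + ‖T y‖ * ‖(j n ∘L S - T) x‖ :=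
          (norm_add_le _ _).trans
            (add_le_add (CStarModule.norm_inner_le Z) (CStarModule.norm_inner_le Z))
      _ ≤ (ε * ‖y‖) * ((‖T‖ + 1) * ‖x‖) + (‖T‖ * ‖y‖) * (ε * ‖x‖) := by
          gcongr
          · exact ContinuousLinearMap.le_of_opNorm_le _ hST.le _
          · exact ContinuousLinearMap.le_of_opNorm_le _ hjS _
          · exact T.le_opNorm _
          · exact ContinuousLinearMap.le_of_opNorm_le _ hST.le _
      _ = ε * (2 * ‖T‖ + 1) * ‖y‖ * ‖x‖ := by ring
      _ = _ := by rw [hε1]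
  obtain ⟨U, U', hU, hUU⟩ := exists_isometric_on_fixed (T := T')
    (adjointable.isSelfAdjoint_iff.mpr hTT) hS hclose
  refine ⟨n, U ∘L i, fun x y => ?_, U ∘L T ∘L U', conj_mem_compactOperators hU hT,
    hU.comp (hTT.comp hU.symm), fun w => ?_⟩
  · rw [ContinuousLinearMap.comp_apply, ContinuousLinearMap.comp_apply, hU, hUU _ (hTi y), hi]
  · simp [hUU _ (hTi w), hTi]

end Exhaustion

/-! ### Exhaustion of a countably generated module by compactly contained submodules -/

/-- The image of a countably generated module under an `A`-linear map with dense range generates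
the codomain. -/
theorem countablyGenerated_of_denseRange {X Y : HilbertModule A} (hX : X.CountablyGenerated)
    (f : X →L[ℂ] Y) (hf : ∀ (a : Aᵐᵒᵖ) (x : X), f (a • x) = a • f x) (hd : DenseRange f) :
    Y.CountablyGenerated := by
  obtain ⟨x, hx⟩ := hX
  refine ⟨fun i => f (x i), (hd.dense_image f.continuous hx).mono ?_⟩
  rintro _ ⟨z, hz, rfl⟩
  refine Submodule.span_le (p := (Submodule.span ℂ
    {w : Y | ∃ (i : ℕ) (a : Aᵐᵒᵖ), w = a • f (x i)}).comap f.toLinearMap) |>.mpr ?_ hz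
  rintro _ ⟨i, a, rfl⟩
  exact Submodule.subset_span ⟨i, a, hf a (x i)⟩

theorem continuous_smul_right {X : HilbertModule A} (a : Aᵐᵒᵖ) : Continuous fun x : X => a • x :=
  (LipschitzWith.of_dist_le_mul (K := ‖a‖₊) fun x y => by
    have : a • x - a • y = a • (x - y) := by
      refine ext_inner Aᵐᵒᵖ fun z => ?_
      simp [mul_sub]
    rw [dist_eq_norm, dist_eq_norm, this]
    exact norm_smul_le' a _).continuous

section RangeClosure

variable {X : HilbertModule A}

/-- The closure of the range of an adjointable operator, as a Hilbert submodule. -/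
def rangeClosure (e : adjointable X) : HilbertSubmodule X where
  toSubmodule := (LinearMap.range (e : X →L[ℂ] X).toLinearMap).topologicalClosure
  smul_mem_right := fun a {x} hx => by
    refine map_mem_closure (continuous_smul_right a) hx ?_
    rintro _ ⟨y, rfl⟩
    exact ⟨a • y, (adjointable.isAdjointPair_star e).map_smul a y⟩
  isClosed := Submodule.isClosed_topologicalClosure _

theorem mem_rangeClosure (e : adjointable X) (x : X) :
    (e : X →L[ℂ] X) x ∈ (rangeClosure e).toSubmodule :=
  Submodule.le_topologicalClosure _ ⟨x, rfl⟩

theorem countablyGenerated_rangeClosure (hX : X.CountablyGenerated) (e : adjointable X) :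
    (rangeClosure e).toHilbertModule.CountablyGenerated := by
  let f : X →L[ℂ] (rangeClosure e).toHilbertModule :=
    (e : X →L[ℂ] X).codRestrict (rangeClosure e).toSubmodule (mem_rangeClosure e)
  refine countablyGenerated_of_denseRange hX f (fun a x => Subtype.ext
    ((adjointable.isAdjointPair_star e).map_smul a x)) ?_
  have : Dense (Set.range f : Set (rangeClosure e).toSubmodule) := by
    rw [Subtype.dense_iff]
    intro x hx
    refine closure_mono ?_ hx
    rintro _ ⟨y, rfl⟩
    exact ⟨f y, ⟨y, rfl⟩, rfl⟩
  exact this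

/-- The inclusion of a Hilbert submodule. -/
noncomputable def inclusion (X₀ : HilbertSubmodule X) : X₀.toHilbertModule →L[ℂ] X :=
  X₀.toSubmodule.subtypeL

theorem isEmbedding_inclusion (X₀ : HilbertSubmodule X) : IsEmbedding (inclusion X₀) :=
  fun _ _ => rfl

theorem range_inclusion (X₀ : HilbertSubmodule X) :
    Set.range (inclusion X₀) = (X₀.toSubmodule : Set X) :=
  Subtype.range_coe

theorem apply_eq_of_mem_rangeClosure {e e' : adjointable X} (h : e' * e = e) {x : X}
    (hx : x ∈ (rangeClosure e).toSubmodule) : (e' : X →L[ℂ] X) x = x := by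
  have hc : IsClosed {x : X | (e' : X →L[ℂ] X) x = x} :=
    isClosed_eq (e' : X →L[ℂ] X).continuous continuous_id
  refine hc.closure_subset_iff.mpr ?_ hx
  rintro _ ⟨y, rfl⟩
  change ((e' * e : adjointable X) : X →L[ℂ] X) y = _
  rw [h]
  rfl

theorem compactlyEmbeds_rangeClosure {e e' : adjointable X} (h : e' * e = e)
    (hsa : IsSelfAdjoint e') (hK : (e' : X →L[ℂ] X) ∈ compactOperators X) :
    CompactlyEmbeds (rangeClosure e).toHilbertModule X :=
  ⟨inclusion _, isEmbedding_inclusion _, _, hK, adjointable.isSelfAdjoint_iff.mp hsa,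
    fun w => apply_eq_of_mem_rangeClosure h w.2⟩

end RangeClosure

/-- A continuous function that vanishes for `t ≤ 2 ^ (-n)` and is `1` for `2 ^ (1 - n) ≤ t`. -/
noncomputable def ramp (n : ℕ) (t : ℝ) : ℝ := max 0 (min 1 (2 ^ n * t - 1))

theorem continuous_ramp (n : ℕ) : Continuous (ramp n) := by unfold ramp; fun_prop

theorem ramp_succ_mul_ramp (n : ℕ) (t : ℝ) : ramp (n + 1) t * ramp n t = ramp n t := by
  rcases le_total (2 ^ n * t) 1 with h | h
  · have : ramp n t = 0 := max_eq_left ((min_le_right _ _).trans (by linarith))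
    rw [this, mul_zero]
  · have : ramp (n + 1) t = 1 := by
      rw [ramp, min_eq_left (by rw [pow_succ]; linarith), max_eq_right zero_le_one]
    rw [this, one_mul]

theorem mul_sq_one_sub_ramp_le (n : ℕ) {t : ℝ} (ht : 0 ≤ t) :
    0 ≤ t * (1 - ramp n t) ^ 2 ∧ t * (1 - ramp n t) ^ 2 ≤ 2 * (1 / 2) ^ n := by
  refine ⟨by positivity, ?_⟩
  rcases le_total 2 (2 ^ n * t) with h | h
  · have : ramp n t = 1 := by
      rw [ramp, min_eq_left (by linarith), max_eq_right zero_le_one]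
    rw [this]; simp
  · have h0 : 0 ≤ ramp n t := le_max_left _ _
    have h1 : ramp n t ≤ 1 := max_le zero_le_one (min_le_left _ _)
    have h2 : t ≤ 2 * (1 / 2) ^ n := by
      rw [one_div, inv_pow, ← div_eq_mul_inv, le_div_iff₀ (by positivity)]
      linarith
    have h3 : (1 - ramp n t) ^ 2 ≤ 1 := by nlinarith
    nlinarith

/-- `ramp n` is divisible by `t`, so that it maps compact operators to compact operators, which form
an ideal. -/
theorem exists_mul_eq_ramp (n : ℕ) : ∃ g : ℝ → ℝ, Continuous g ∧ ∀ t, t * g t = ramp n t := by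
  have hpos : ∀ t : ℝ, (0 : ℝ) < max t ((1 / 2) ^ n) := fun t =>
    lt_max_of_lt_right (by positivity)
  refine ⟨fun t => ramp n t * (max t ((1 / 2) ^ n))⁻¹, (continuous_ramp n).mul
    (Continuous.inv₀ (by fun_prop) fun t => (hpos t).ne'), fun t => ?_⟩
  rcases le_total t ((1 / 2) ^ n) with h | h
  · have : ramp n t = 0 := by
      refine max_eq_left ((min_le_right _ _).trans ?_)
      rw [one_div, inv_pow] at h
      have := mul_le_mul_of_nonneg_left h (show (0 : ℝ) ≤ 2 ^ n by positivity)
      rw [mul_inv_cancel₀ (by positivity)] at this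
      linarith
    simp [this]
  · have := (hpos t).ne'
    simp only [max_eq_left h] at this ⊢
    field_simp

section StrictlyPositive

variable {X : HilbertModule A}

/-- A sequence in `X` is dominated by a positive compact operator: `h` is a weighted sum of the
operators `θ_{x,x}`. -/
theorem exists_dominating (x : ℕ → X) : ∃ h : adjointable X, 0 ≤ h ∧
    (h : X →L[ℂ] X) ∈ compactOperators X ∧
    ∀ i, ∃ C : ℝ, 0 ≤ C ∧
      (⟨theta (x i) (x i), adjointable.theta_mem _ _⟩ : adjointable X) ≤ C • h := by
  let θ : ℕ → adjointable X := fun i => ⟨theta (x i) (x i), adjointable.theta_mem _ _⟩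
  have hθ : ∀ i, 0 ≤ θ i := fun i => adjointable.theta_self_nonneg (x i)
  let c : ℕ → ℝ := fun i => (1 / 2) ^ i / (1 + ‖x i‖ ^ 2)
  have hc : ∀ i, 0 < c i := fun i => by positivity
  have hsum : Summable fun i => c i • θ i := by
    refine Summable.of_norm_bounded summable_geometric_two fun i => ?_
    have : ‖θ i‖ = ‖x i‖ ^ 2 := norm_theta_self (x i)
    rw [norm_smul, this, Real.norm_of_nonneg (hc i).le, div_mul_eq_mul_div,
      div_le_iff₀ (by positivity)]
    gcongr
    linarith
  have hnn : ∀ i, 0 ≤ c i • θ i := fun i => smul_nonneg (hc i).le (hθ i)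
  refine ⟨∑' i, c i • θ i, tsum_nonneg hnn, ?_, fun i => ⟨(c i)⁻¹, (inv_pos.mpr (hc i)).le, ?_⟩⟩
  · have hcl : IsClosed {T : adjointable X | (T : X →L[ℂ] X) ∈ compactOperators X} :=
      isClosed_compactOperators.preimage continuous_subtype_val
    refine hcl.mem_of_tendsto hsum.hasSum (Eventually.of_forall fun s => ?_)
    have : ((compactOperators X).comap (adjointable X).toSubmodule.subtype : Set (adjointable X)) =
      {T : adjointable X | (T : X →L[ℂ] X) ∈ compactOperators X} := rfl
    rw [← this]
    refine sum_mem fun i _ => ?_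
    have e : c i • θ i = (c i : ℂ) • θ i := (Complex.coe_smul (c i) (θ i)).symm
    rw [e]
    exact Submodule.smul_mem _ _ (theta_mem_compactOperators _ _)
  · have := hsum.le_tsum i fun j _ => hnn j
    have := smul_le_smul_of_nonneg_left this (inv_pos.mpr (hc i)).le
    rwa [smul_smul, inv_mul_cancel₀ (hc i).ne', one_smul] at this

/-- If `h` dominates `θ_{x,x}`, then the spectral cut-offs of `h` act on `x` as an approximate
unit. -/
theorem tendsto_cfc_ramp_apply {h : adjointable X} (hh : 0 ≤ h) {x : X} {C : ℝ} (hC : 0 ≤ C)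
    (hx : (⟨theta x x, adjointable.theta_mem _ _⟩ : adjointable X) ≤ C • h) :
    Tendsto (fun n => ((cfc (ramp n) h : adjointable X) : X →L[ℂ] X) x) atTop (𝓝 x) := by
  have hlim : Tendsto (fun n : ℕ => √(C * (2 * (1 / 2 : ℝ) ^ n))) atTop (𝓝 0) := by
    have h1 : Tendsto (fun n : ℕ => (1 / 2 : ℝ) ^ n) atTop (𝓝 0) :=
      tendsto_pow_atTop_nhds_zero_of_lt_one (by norm_num) (by norm_num)
    simpa using ((h1.const_mul 2).const_mul C).sqrt
  rw [tendsto_iff_norm_sub_tendsto_zero]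
  refine squeeze_zero (fun _ => norm_nonneg _) (fun n => ?_) hlim
  have hrc := continuous_ramp n
  set v : adjointable X := cfc (fun t => 1 - ramp n t) h with hv
  have hvsa : IsSelfAdjoint v := cfc_predicate _ _
  have hvu : v = 1 - cfc (ramp n) h := by
    rw [hv, cfc_sub _ _ h, cfc_const_one ℝ h]
  have hvx : (v : X →L[ℂ] X) x = x - ((cfc (ramp n) h : adjointable X) : X →L[ℂ] X) x := by
    rw [hvu]; rfl
  rw [norm_sub_rev, ← hvx]
  refine Real.le_sqrt_of_sq_le ?_
  have e : ((v * ⟨theta x x, adjointable.theta_mem _ _⟩ * v : adjointable X) : X →L[ℂ] X) =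
      theta ((v : X →L[ℂ] X) x) ((v : X →L[ℂ] X) x) := by
    have hp := adjointable.isSelfAdjoint_iff.mp hvsa
    change ((v : X →L[ℂ] X) ∘L theta x x) ∘L (v : X →L[ℂ] X) = _
    rw [comp_theta hp, theta_comp hp]
  have e2 : v * h * v = cfc (fun t => t * (1 - ramp n t) ^ 2) h := by
    conv_lhs => enter [1, 2]; rw [← cfc_id' ℝ h]
    rw [hv, ← cfc_mul _ _ h, ← cfc_mul _ _ h]
    congr 1; ext t; ring
  calc ‖(v : X →L[ℂ] X) x‖ ^ 2
      = ‖(v * ⟨theta x x, adjointable.theta_mem _ _⟩ * v : adjointable X)‖ := by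
        rw [← adjointable.norm_coe, e, norm_theta_self]
    _ ≤ ‖C • (v * h * v)‖ := by
        refine CStarAlgebra.norm_le_norm_of_nonneg_of_le
          (hvsa.conjugate_nonneg (adjointable.theta_self_nonneg x)) ?_
        have := hvsa.conjugate_le_conjugate hx
        rwa [mul_smul_comm, smul_mul_assoc] at this
    _ ≤ C * (2 * (1 / 2) ^ n) := by
        rw [norm_smul, Real.norm_of_nonneg hC, e2]
        gcongr
        refine norm_cfc_le (by positivity) fun t ht => ?_
        have ht0 := spectrum_nonneg_of_nonneg hh ht
        rw [Real.norm_of_nonneg (mul_sq_one_sub_ramp_le n ht0).1]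
        exact (mul_sq_one_sub_ramp_le n ht0).2

end StrictlyPositive

/-- A countably generated module is the closure of an increasing union of countably generated,
compactly contained submodules. -/
theorem exists_exhaustion (X : CGModule A) :
    ∃ (V : ℕ → CGModule A) (j : ∀ n, (V n).toHilbertModule →L[ℂ] X.toHilbertModule),
      (∀ n, IsEmbedding (j n)) ∧ (Monotone fun n => Set.range (j n)) ∧
      Dense (⋃ n, Set.range (j n)) ∧
      ∀ n, CompactlyEmbeds (V n).toHilbertModule X.toHilbertModule := by
  obtain ⟨X, hX⟩ := X
  obtain ⟨x, hx⟩ := id hX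
  obtain ⟨h, hh, hK, hdom⟩ := exists_dominating x
  let e : ℕ → adjointable X := fun n => cfc (ramp n) h
  have hesa : ∀ n, IsSelfAdjoint (e n) := fun n => cfc_predicate _ _
  have hee : ∀ n, e (n + 1) * e n = e n := fun n => by
    have h1 := continuous_ramp n
    have h2 := continuous_ramp (n + 1)
    change cfc (ramp (n + 1)) h * cfc (ramp n) h = cfc (ramp n) h
    rw [← cfc_mul _ _ h]
    congr 1; ext t; exact ramp_succ_mul_ramp n t
  have heK : ∀ n, (e n : X →L[ℂ] X) ∈ compactOperators X := fun n => by
    obtain ⟨g, hg, hgr⟩ := exists_mul_eq_ramp n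
    have : e n = h * cfc g h := by
      conv_rhs => enter [1]; rw [← cfc_id' ℝ h]
      rw [← cfc_mul _ _ h]
      change cfc (ramp n) h = _
      congr 1; ext t; exact (hgr t).symm
    rw [this]
    exact comp_mem_compactOperators (adjointable.isAdjointPair_star _) hK
  have hmono : Monotone fun n => (rangeClosure (e n)).toSubmodule :=
    monotone_nat_of_le_succ fun n z hz => by
      rw [← apply_eq_of_mem_rangeClosure (hee n) hz]
      exact mem_rangeClosure _ _
  refine ⟨fun n => ⟨(rangeClosure (e n)).toHilbertModule, countablyGenerated_rangeClosure hX _⟩,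
    fun n => inclusion _, fun n => isEmbedding_inclusion _, fun m n hmn => ?_, ?_,
    fun n => compactlyEmbeds_rangeClosure (hee n) (hesa _) (heK _)⟩
  · simp only [range_inclusion]
    exact hmono hmn
  · simp only [range_inclusion]
    rw [← Submodule.coe_iSup_of_directed _ hmono.directed_le]
    set N : Submodule ℂ X := ⨆ n, (rangeClosure (e n)).toSubmodule
    have hle : Submodule.span ℂ {z : X | ∃ (i : ℕ) (a : Aᵐᵒᵖ), z = a • x i} ≤
        N.topologicalClosure := by
      rw [Submodule.span_le]
      rintro _ ⟨i, a, rfl⟩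
      obtain ⟨C, hC, hCi⟩ := hdom i
      have hlim := ((continuous_smul_right a).tendsto _).comp (tendsto_cfc_ramp_apply hh hC hCi)
      refine mem_closure_of_tendsto hlim (Eventually.of_forall fun n => ?_)
      exact Submodule.mem_iSup_of_mem n
        ((rangeClosure (e n)).smul_mem_right a (mem_rangeClosure (e n) (x i)))
    intro z
    exact (Submodule.isClosed_topologicalClosure N).closure_subset_iff.mpr hle (hx z)

/-! ### Inductive limits of Hilbert modules -/

section DirectLimit

variable {V : ℕ → HilbertModule A} {φ : ∀ n, V n →L[ℂ] V (n + 1)}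

/-- The sequences that are eventually compatible with the connecting maps. -/
def threads (φ : ∀ n, V n →L[ℂ] V (n + 1)) : Submodule ℂ (∀ n, V n) where
  carrier := {x | ∀ᶠ n in atTop, x (n + 1) = φ n (x n)}
  add_mem' := fun hx hy => by
    filter_upwards [hx, hy] with n hxn hyn
    simp [hxn, hyn]
  zero_mem' := Eventually.of_forall fun n => by simp
  smul_mem' := fun c x hx => by
    filter_upwards [hx] with n hxn
    simp [hxn]

/-- The algebraic inductive limit of a sequence of embeddings, before elements at distance zero are
identified: eventually compatible sequences, with the eventual value of the inner products. -/
def PreLimit (_ : ∀ n, IsEmbedding (φ n)) : Type u := threads φ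

namespace PreLimit

variable {hφ : ∀ n, IsEmbedding (φ n)}

instance : AddCommGroup (PreLimit hφ) := inferInstanceAs (AddCommGroup (threads φ))

instance : Module ℂ (PreLimit hφ) := inferInstanceAs (Module ℂ (threads φ))

/-- The terms of an eventually compatible sequence. -/
def coord (x : PreLimit hφ) (n : ℕ) : V n := x.1 n

theorem coord_add (x y : PreLimit hφ) (n : ℕ) : (x + y).coord n = x.coord n + y.coord n := rfl

theorem coord_sub (x y : PreLimit hφ) (n : ℕ) : (x - y).coord n = x.coord n - y.coord n := rfl

theorem coord_neg (x : PreLimit hφ) (n : ℕ) : (-x).coord n = -x.coord n := rfl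

theorem coord_zero (n : ℕ) : (0 : PreLimit hφ).coord n = 0 := rfl

theorem coord_smul (c : ℂ) (x : PreLimit hφ) (n : ℕ) : (c • x).coord n = c • x.coord n := rfl

theorem eventually_coord_succ (x : PreLimit hφ) :
    ∀ᶠ n in atTop, x.coord (n + 1) = φ n (x.coord n) := x.2

instance : SMul Aᵐᵒᵖ (PreLimit hφ) :=
  ⟨fun a x => ⟨fun n => a • x.coord n, by
    filter_upwards [x.eventually_coord_succ] with n hn
    rw [hn, (hφ n).map_smul]⟩⟩

theorem coord_smul_right (a : Aᵐᵒᵖ) (x : PreLimit hφ) (n : ℕ) :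
    (a • x).coord n = a • x.coord n := rfl

theorem exists_eventually_inner (x y : PreLimit hφ) :
    ∃ c : Aᵐᵒᵖ, ∀ᶠ n in atTop, (inner Aᵐᵒᵖ (x.coord n) (y.coord n) : Aᵐᵒᵖ) = c := by
  obtain ⟨N, hN⟩ := eventually_atTop.mp (x.eventually_coord_succ.and y.eventually_coord_succ)
  refine ⟨inner Aᵐᵒᵖ (x.coord N) (y.coord N), eventually_atTop.mpr ⟨N, fun n hn => ?_⟩⟩
  induction n, hn using Nat.le_induction with
  | base => rfl
  | succ n hn ih => rw [(hN n hn).1, (hN n hn).2, hφ n, ih]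

noncomputable instance : Inner Aᵐᵒᵖ (PreLimit hφ) :=
  ⟨fun x y => (exists_eventually_inner x y).choose⟩

theorem eventually_inner (x y : PreLimit hφ) :
    ∀ᶠ n in atTop, (inner Aᵐᵒᵖ (x.coord n) (y.coord n) : Aᵐᵒᵖ) = inner Aᵐᵒᵖ x y :=
  (exists_eventually_inner x y).choose_spec

noncomputable instance : Norm (PreLimit hφ) := ⟨fun x => √‖(inner Aᵐᵒᵖ x x : Aᵐᵒᵖ)‖⟩

theorem norm_def (x : PreLimit hφ) : ‖x‖ = √‖(inner Aᵐᵒᵖ x x : Aᵐᵒᵖ)‖ := rfl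

theorem eventually_norm (x : PreLimit hφ) : ∀ᶠ n in atTop, ‖x.coord n‖ = ‖x‖ := by
  filter_upwards [eventually_inner x x] with n hn
  rw [norm_def, ← hn, CStarModule.norm_eq_sqrt_norm_inner_self (A := Aᵐᵒᵖ)]

theorem norm_add_le' (x y : PreLimit hφ) : ‖x + y‖ ≤ ‖x‖ + ‖y‖ := by
  obtain ⟨n, h1, h2, h3⟩ := (x.eventually_norm.and
    (y.eventually_norm.and (x + y).eventually_norm)).exists
  rw [← h1, ← h2, ← h3, coord_add]
  exact norm_add_le _ _

noncomputable instance : SeminormedAddCommGroup (PreLimit hφ) :=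
  AddGroupSeminorm.toSeminormedAddCommGroup
    { toFun := fun x => ‖x‖
      map_zero' := by
        obtain ⟨n, h⟩ := (0 : PreLimit hφ).eventually_norm.exists
        rw [← h, coord_zero, norm_zero]
      add_le' := norm_add_le'
      neg' := fun x => by
        obtain ⟨n, h1, h2⟩ := (x.eventually_norm.and (-x).eventually_norm).exists
        rw [← h1, ← h2, coord_neg, norm_neg] }

noncomputable instance : NormedSpace ℂ (PreLimit hφ) where
  norm_smul_le c x := by
    obtain ⟨n, h1, h2⟩ := (x.eventually_norm.and (c • x).eventually_norm).exists
    rw [← h1, ← h2, coord_smul]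
    exact norm_smul_le _ _

theorem inner_add_right (x y z : PreLimit hφ) :
    (inner Aᵐᵒᵖ x (y + z) : Aᵐᵒᵖ) = inner Aᵐᵒᵖ x y + inner Aᵐᵒᵖ x z := by
  obtain ⟨n, h1, h2, h3⟩ := ((eventually_inner x y).and
    ((eventually_inner x z).and (eventually_inner x (y + z)))).exists
  rw [← h1, ← h2, ← h3, coord_add, CStarModule.inner_add_right]

theorem star_inner (x y : PreLimit hφ) :
    star (inner Aᵐᵒᵖ x y : Aᵐᵒᵖ) = inner Aᵐᵒᵖ y x := by
  obtain ⟨n, h1, h2⟩ := ((eventually_inner x y).and (eventually_inner y x)).exists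
  rw [← h1, ← h2, CStarModule.star_inner]

theorem inner_smul_right_complex (c : ℂ) (x y : PreLimit hφ) :
    (inner Aᵐᵒᵖ x (c • y) : Aᵐᵒᵖ) = c • inner Aᵐᵒᵖ x y := by
  obtain ⟨n, h1, h2⟩ := ((eventually_inner x y).and (eventually_inner x (c • y))).exists
  rw [← h1, ← h2, coord_smul, CStarModule.inner_smul_right_complex]

theorem inner_smul_right (a : Aᵐᵒᵖ) (x y : PreLimit hφ) :
    (inner Aᵐᵒᵖ x (a • y) : Aᵐᵒᵖ) = a * inner Aᵐᵒᵖ x y := by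
  obtain ⟨n, h1, h2⟩ := ((eventually_inner x y).and (eventually_inner x (a • y))).exists
  rw [← h1, ← h2, coord_smul_right, CStarModule.inner_op_smul_right]

theorem inner_self_nonneg (x : PreLimit hφ) : (0 : Aᵐᵒᵖ) ≤ inner Aᵐᵒᵖ x x := by
  obtain ⟨n, h⟩ := (eventually_inner x x).exists
  exact h ▸ CStarModule.inner_self_nonneg

theorem norm_inner_le (x y : PreLimit hφ) : ‖(inner Aᵐᵒᵖ x y : Aᵐᵒᵖ)‖ ≤ ‖x‖ * ‖y‖ := by
  obtain ⟨n, h1, h2, h3⟩ := ((eventually_inner x y).and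
    (x.eventually_norm.and y.eventually_norm)).exists
  rw [← h1, ← h2, ← h3]
  exact CStarModule.norm_inner_le (V n)

/-- The inner product as a sesquilinear map. -/
noncomputable def innerₛₗ : PreLimit hφ →ₗ⋆[ℂ] PreLimit hφ →ₗ[ℂ] Aᵐᵒᵖ :=
  LinearMap.mk₂'ₛₗ (starRingEnd ℂ) (RingHom.id ℂ) (fun x y => inner Aᵐᵒᵖ x y)
    (fun x y z => by
      rw [← star_inner, inner_add_right, star_add, star_inner, star_inner])
    (fun c x y => by
      rw [← star_inner, inner_smul_right_complex, star_smul, star_inner]; rfl)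
    inner_add_right
    (fun c x y => inner_smul_right_complex c x y)

theorem continuous_inner :
    Continuous fun p : PreLimit hφ × PreLimit hφ => (inner Aᵐᵒᵖ p.1 p.2 : Aᵐᵒᵖ) := by
  let B : PreLimit hφ →L⋆[ℂ] PreLimit hφ →L[ℂ] Aᵐᵒᵖ := innerₛₗ.mkContinuous₂ 1 fun x y => by
    rw [one_mul]
    exact norm_inner_le x y
  change Continuous fun p : PreLimit hφ × PreLimit hφ => B p.1 p.2
  fun_prop

instance : UniformContinuousConstSMul Aᵐᵒᵖ (PreLimit hφ) where
  uniformContinuous_const_smul a :=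
    (LipschitzWith.of_dist_le_mul (K := ‖a‖₊) fun x y => by
      rw [dist_eq_norm, dist_eq_norm]
      obtain ⟨n, h1, h2⟩ := ((x - y).eventually_norm.and (a • x - a • y).eventually_norm).exists
      rw [← h1, ← h2]
      have : (a • x - a • y).coord n = a • (x - y).coord n := by
        refine ext_inner Aᵐᵒᵖ fun z => ?_
        simp [coord_sub, coord_smul_right, mul_sub]
      rw [this]
      exact norm_smul_le' a _).uniformContinuous

theorem completion_inner_coe (x y : PreLimit hφ) :
    (inner Aᵐᵒᵖ (x : Completion (PreLimit hφ)) (y : Completion (PreLimit hφ)) : Aᵐᵒᵖ) =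
      inner Aᵐᵒᵖ x y :=
  (Completion.isDenseInducing_coe.prodMap Completion.isDenseInducing_coe).extend_eq
    (f := Function.uncurry (inner Aᵐᵒᵖ)) continuous_inner (x, y)

theorem continuous_completion_inner :
    Continuous (Function.uncurry (inner Aᵐᵒᵖ (E := Completion (PreLimit hφ)))) := by
  let inner' : PreLimit hφ →+ PreLimit hφ →+ Aᵐᵒᵖ :=
    { toFun := fun x => (innerₛₗ x).toAddMonoidHom
      map_zero' := by ext x; simp
      map_add' := fun x y => by ext z; simp }
  have : Continuous fun p : PreLimit hφ × PreLimit hφ => inner' p.1 p.2 := continuous_inner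
  exact (Completion.isDenseInducing_toCompl (PreLimit hφ)).extend_Z_bilin
    (Completion.isDenseInducing_toCompl (PreLimit hφ)) this

theorem _root_.Continuous.completion_preLimit_inner {α : Type*} [TopologicalSpace α]
    {f g : α → Completion (PreLimit hφ)} (hf : Continuous f) (hg : Continuous g) :
    Continuous fun t => (inner Aᵐᵒᵖ (f t) (g t) : Aᵐᵒᵖ) :=
  continuous_completion_inner.comp (hf.prodMk hg)

theorem completion_norm_eq (x : Completion (PreLimit hφ)) :
    ‖x‖ = √‖(inner Aᵐᵒᵖ x x : Aᵐᵒᵖ)‖ :=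
  Completion.induction_on x (isClosed_eq continuous_norm
    ((continuous_id.completion_preLimit_inner continuous_id).norm.sqrt)) fun a => by
      rw [Completion.norm_coe, completion_inner_coe, norm_def]

noncomputable instance : CStarModule Aᵐᵒᵖ (Completion (PreLimit hφ)) where
  inner_add_right {x y z} :=
    Completion.induction_on₃ x y z
      (isClosed_eq
        (continuous_fst.completion_preLimit_inner
          ((continuous_fst.comp continuous_snd).add (continuous_snd.comp continuous_snd)))
        ((continuous_fst.completion_preLimit_inner (continuous_fst.comp continuous_snd)).add
          (continuous_fst.completion_preLimit_inner (continuous_snd.comp continuous_snd))))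
      fun a b c => by
        rw [← Completion.coe_add]
        simp only [completion_inner_coe, inner_add_right]
  inner_self_nonneg {x} :=
    Completion.induction_on x
      (isClosed_Ici.preimage (continuous_id.completion_preLimit_inner continuous_id))
      fun a => by rw [completion_inner_coe]; exact inner_self_nonneg a
  inner_self {x} := by
    rw [← norm_eq_zero (a := x), completion_norm_eq, Real.sqrt_eq_zero (norm_nonneg _),
      norm_eq_zero]
  inner_op_smul_right {a x y} :=
    Completion.induction_on₂ x y
      (isClosed_eq
        (continuous_fst.completion_preLimit_inner (continuous_snd.const_smul a))
        ((continuous_const_mul a).comp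
          (continuous_fst.completion_preLimit_inner continuous_snd)))
      fun b c => by
        rw [← Completion.coe_smul]
        simp only [completion_inner_coe, inner_smul_right]
  inner_smul_right_complex {c x y} :=
    Completion.induction_on₂ x y
      (isClosed_eq
        (continuous_fst.completion_preLimit_inner (continuous_snd.const_smul c))
        ((continuous_const_smul c).comp
          (continuous_fst.completion_preLimit_inner continuous_snd)))
      fun a b => by
        rw [← Completion.coe_smul]
        simp only [completion_inner_coe, inner_smul_right_complex]
  star_inner x y :=
    Completion.induction_on₂ x y
      (isClosed_eq
        (continuous_star.comp (continuous_fst.completion_preLimit_inner continuous_snd))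
        (continuous_snd.completion_preLimit_inner continuous_fst))
      fun a b => by simp only [completion_inner_coe, star_inner]
  norm_eq_sqrt_norm_inner_self := completion_norm_eq

end PreLimit

/-- The composite `V n → V k` of connecting maps for `n ≤ k`, and zero for `k < n`. -/
noncomputable def connecting (φ : ∀ n, V n →L[ℂ] V (n + 1)) (n : ℕ) : ∀ k, V n →ₗ[ℂ] V k
  | 0 => if h : n = 0 then h ▸ LinearMap.id else 0
  | k + 1 => if h : n = k + 1 then h ▸ LinearMap.id else (φ k).toLinearMap ∘ₗ connecting φ n k

theorem connecting_self (n : ℕ) (x : V n) : connecting φ n n x = x := by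
  cases n <;> simp [connecting]

theorem connecting_succ {n k : ℕ} (h : n ≤ k) (x : V n) :
    connecting φ n (k + 1) x = φ k (connecting φ n k x) := by
  have : n ≠ k + 1 := by lia
  simp [connecting, this]

/-- A compatible sequence is determined, from any index on, by its term at that index. -/
theorem eq_connecting {n : ℕ} {x : ∀ k, V k} (hx : ∀ k, n ≤ k → x (k + 1) = φ k (x k)) {k : ℕ}
    (hk : n ≤ k) : x k = connecting φ n k (x n) := by
  induction k, hk using Nat.le_induction with
  | base => rw [connecting_self]
  | succ k hk ih => rw [hx k hk, connecting_succ hk, ih]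

/-- The canonical map of a member of the sequence to the algebraic inductive limit. -/
noncomputable def toPreLimit (hφ : ∀ n, IsEmbedding (φ n)) (n : ℕ) : V n →ₗ[ℂ] PreLimit hφ where
  toFun x := ⟨fun k => connecting φ n k x,
    eventually_atTop.mpr ⟨n, fun _ hk => connecting_succ hk x⟩⟩
  map_add' x y := Subtype.ext (by ext k; simp; rfl)
  map_smul' c x := Subtype.ext (by ext k; simp; rfl)

theorem coord_toPreLimit (hφ : ∀ n, IsEmbedding (φ n)) (n k : ℕ) (x : V n) :
    (toPreLimit hφ n x).coord k = connecting φ n k x := rfl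

theorem inner_toPreLimit (hφ : ∀ n, IsEmbedding (φ n)) (n : ℕ) (x y : V n) :
    (inner Aᵐᵒᵖ (toPreLimit hφ n x) (toPreLimit hφ n y) : Aᵐᵒᵖ) = inner Aᵐᵒᵖ x y := by
  obtain ⟨k, hk, hnk⟩ := ((PreLimit.eventually_inner (toPreLimit hφ n x) (toPreLimit hφ n y)).and
    (eventually_ge_atTop n)).exists
  rw [← hk, coord_toPreLimit, coord_toPreLimit]
  clear hk
  induction k, hnk using Nat.le_induction with
  | base => rw [connecting_self, connecting_self]
  | succ k hk ih => rw [connecting_succ hk, connecting_succ hk, hφ, ih]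

/-- An element of the algebraic inductive limit has distance zero to the image of each of its
terms of large index. -/
theorem coe_eq_coe_toPreLimit {hφ : ∀ n, IsEmbedding (φ n)} (x : PreLimit hφ) {n : ℕ}
    (hx : ∀ k, n ≤ k → x.coord (k + 1) = φ k (x.coord k)) :
    (x : Completion (PreLimit hφ)) = (toPreLimit hφ n (x.coord n) : PreLimit hφ) := by
  rw [← sub_eq_zero, ← norm_eq_zero, ← Completion.coe_sub, Completion.norm_coe]
  obtain ⟨k, hk, hnk⟩ := ((x - toPreLimit hφ n (x.coord n)).eventually_norm.and
    (eventually_ge_atTop n)).exists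
  rw [← hk, PreLimit.coord_sub, coord_toPreLimit, eq_connecting hx hnk, sub_self, norm_zero]

/-- Inductive limits of sequences of embeddings of Hilbert modules exist. -/
theorem exists_inductiveLimit (hφ : ∀ n, IsEmbedding (φ n)) :
    ∃ (Z : HilbertModule A) (j : ∀ n, V n →L[ℂ] Z), (∀ n, IsEmbedding (j n)) ∧
      (Monotone fun n => Set.range (j n)) ∧ Dense (⋃ n, Set.range (j n)) := by
  let Z : HilbertModule A := { carrier := Completion (PreLimit hφ) }
  have hj : ∀ n, ∃ j : V n →L[ℂ] Z, IsEmbedding j ∧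
      ∀ x, j x = (toPreLimit hφ n x : Completion (PreLimit hφ)) := fun n =>
    exists_isEmbedding_of_inner (Y := Z)
      ((Completion.toComplL (𝕜 := ℂ) (E := PreLimit hφ)).toLinearMap ∘ₗ toPreLimit hφ n)
      fun x y => (PreLimit.completion_inner_coe _ _).trans (inner_toPreLimit hφ n x y)
  choose j hj hjx using hj
  refine ⟨Z, j, hj, monotone_nat_of_le_succ fun n => ?_, ?_⟩
  · rintro _ ⟨x, rfl⟩
    refine ⟨φ n x, ?_⟩
    rw [hjx, hjx, coe_eq_coe_toPreLimit (toPreLimit hφ n x) (n := n + 1) fun k hk =>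
      connecting_succ (by lia) x, coord_toPreLimit, connecting_succ le_rfl, connecting_self]
  · refine (Completion.denseRange_coe (α := PreLimit hφ)).mono ?_
    rintro _ ⟨x, rfl⟩
    obtain ⟨n, hn⟩ := eventually_atTop.mp x.eventually_coord_succ
    exact Set.mem_iUnion.mpr ⟨n, x.coord n, by rw [hjx, coe_eq_coe_toPreLimit x hn]⟩

end DirectLimit

/-- A module in which an increasing sequence of countably generated submodules is dense is
countably generated. -/
theorem countablyGenerated_of_dense {Z : HilbertModule A} {V : ℕ → HilbertModule A}
    (hV : ∀ n, (V n).CountablyGenerated) {j : ∀ n, V n →L[ℂ] Z} (hj : ∀ n, IsEmbedding (j n))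
    (hd : Dense (⋃ n, Set.range (j n))) : Z.CountablyGenerated := by
  choose x hx using hV
  let f : ℕ × ℕ → Z := fun p => j p.1 (x p.1 p.2)
  let z : ℕ → Z := fun m => f (Nat.unpair m)
  refine ⟨z, ?_⟩
  set S := Submodule.span ℂ {w : Z | ∃ (i : ℕ) (a : Aᵐᵒᵖ), w = a • z i} with hS
  refine fun w => (Submodule.isClosed_topologicalClosure S).closure_subset_iff.mpr ?_ (hd w)
  refine Set.iUnion_subset fun n => ?_
  rintro _ ⟨v, rfl⟩
  have hle : Submodule.span ℂ {w : V n | ∃ (i : ℕ) (a : Aᵐᵒᵖ), w = a • x n i} ≤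
      S.topologicalClosure.comap (j n).toLinearMap := by
    rw [Submodule.span_le]
    rintro _ ⟨i, a, rfl⟩
    refine S.le_topologicalClosure (Submodule.subset_span ⟨Nat.pair n i, a, ?_⟩)
    change j n (a • x n i) = a • f (Nat.unpair (Nat.pair n i))
    rw [Nat.unpair_pair, (hj n).map_smul]
  exact ((Submodule.isClosed_topologicalClosure S).preimage (j n).continuous).closure_subset_iff.mpr
    hle (hx n v)

/-! ### Direct sums -/

section DirectSum

variable {X Y X' Y' Z : HilbertModule A}

/-- The inclusion of the first summand. -/
noncomputable def sumInl : X →L[ℂ] X.directSum Y :=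
  (WithCStarModule.equivL (A := Aᵐᵒᵖ) (E := X × Y) ℂ).symm.toContinuousLinearMap ∘L
    ContinuousLinearMap.inl ℂ X Y

/-- The inclusion of the second summand. -/
noncomputable def sumInr : Y →L[ℂ] X.directSum Y :=
  (WithCStarModule.equivL (A := Aᵐᵒᵖ) (E := X × Y) ℂ).symm.toContinuousLinearMap ∘L
    ContinuousLinearMap.inr ℂ X Y

/-- The projection to the first summand. -/
noncomputable def sumFst : X.directSum Y →L[ℂ] X :=
  ContinuousLinearMap.fst ℂ X Y ∘L
    (WithCStarModule.equivL (A := Aᵐᵒᵖ) (E := X × Y) ℂ).toContinuousLinearMap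

/-- The projection to the second summand. -/
noncomputable def sumSnd : X.directSum Y →L[ℂ] Y :=
  ContinuousLinearMap.snd ℂ X Y ∘L
    (WithCStarModule.equivL (A := Aᵐᵒᵖ) (E := X × Y) ℂ).toContinuousLinearMap

@[simp] theorem sumFst_sumInl (x : X) : sumFst (sumInl x : X.directSum Y) = x := rfl

@[simp] theorem sumSnd_sumInl (x : X) : sumSnd (sumInl x : X.directSum Y) = 0 := rfl

@[simp] theorem sumFst_sumInr (y : Y) : sumFst (sumInr y : X.directSum Y) = 0 := rfl

@[simp] theorem sumSnd_sumInr (y : Y) : sumSnd (sumInr y : X.directSum Y) = y := rfl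

theorem inner_directSum (z w : X.directSum Y) : (inner Aᵐᵒᵖ z w : Aᵐᵒᵖ) =
    inner Aᵐᵒᵖ (sumFst z) (sumFst w) + inner Aᵐᵒᵖ (sumSnd z) (sumSnd w) := rfl

theorem sumInl_add_sumInr (z : X.directSum Y) : sumInl (sumFst z) + sumInr (sumSnd z) = z :=
  ext_inner Aᵐᵒᵖ fun w => by simp [inner_directSum]

theorem isAdjointPair_sumInl : IsAdjointPair (sumInl : X →L[ℂ] X.directSum Y) sumFst :=
  fun x z => by simp [inner_directSum]

theorem isAdjointPair_sumInr : IsAdjointPair (sumInr : Y →L[ℂ] X.directSum Y) sumSnd :=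
  fun x z => by simp [inner_directSum]

/-- The direct sum of two maps. -/
noncomputable def sumMap (f : X →L[ℂ] X') (g : Y →L[ℂ] Y') : X.directSum Y →L[ℂ] X'.directSum Y' :=
  sumInl ∘L f ∘L sumFst + sumInr ∘L g ∘L sumSnd

@[simp]
theorem sumMap_apply (f : X →L[ℂ] X') (g : Y →L[ℂ] Y') (z : X.directSum Y) :
    sumMap f g z = sumInl (f (sumFst z)) + sumInr (g (sumSnd z)) := rfl

theorem IsEmbedding.sumMap {f : X →L[ℂ] X'} {g : Y →L[ℂ] Y'} (hf : IsEmbedding f)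
    (hg : IsEmbedding g) : IsEmbedding (sumMap f g) := fun z w => by
  simp [inner_directSum, hf _ _, hg _ _]

theorem isEmbedding_sumInl : IsEmbedding (sumInl : X →L[ℂ] X.directSum Y) := fun x y => by
  simp [inner_directSum]

theorem isEmbedding_sumFst_zero :
    IsEmbedding (sumFst : X.directSum (HilbertModule.zero A) →L[ℂ] X) := fun z w => by
  have h : (inner Aᵐᵒᵖ (sumSnd z) (sumSnd w) : Aᵐᵒᵖ) = 0 := rfl
  rw [inner_directSum, h, add_zero]

theorem isEmbedding_sumComm :
    IsEmbedding (sumInr ∘L sumFst + sumInl ∘L sumSnd : X.directSum Y →L[ℂ] Y.directSum X) :=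
  fun z w => by simp [inner_directSum, add_comm]

theorem isEmbedding_sumAssoc :
    IsEmbedding (sumInl ∘L sumFst ∘L sumFst +
      sumInr ∘L (sumInl ∘L sumSnd ∘L sumFst + sumInr ∘L sumSnd) :
        (X.directSum Y).directSum Z →L[ℂ] X.directSum (Y.directSum Z)) :=
  fun z w => by simp [inner_directSum, add_assoc]

theorem CompactlyEmbeds.directSum (h : CompactlyEmbeds X X') (k : CompactlyEmbeds Y Y') :
    CompactlyEmbeds (X.directSum Y) (X'.directSum Y') := by
  obtain ⟨i, hi, S, hS, hSS, hSi⟩ := h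
  obtain ⟨j, hj, T, hT, hTT, hTj⟩ := k
  refine ⟨sumMap i j, hi.sumMap hj, sumMap S T,
    add_mem (conj_mem_compactOperators isAdjointPair_sumInl hS)
      (conj_mem_compactOperators isAdjointPair_sumInr hT),
    (isAdjointPair_sumInl.comp (hSS.comp isAdjointPair_sumInl.symm)).add
      (isAdjointPair_sumInr.comp (hTT.comp isAdjointPair_sumInr.symm)), fun w => ?_⟩
  simp [hSi, hTj]

theorem dense_iUnion_range_sumMap {V U : ℕ → HilbertModule A} {j : ∀ n, V n →L[ℂ] X}
    {k : ∀ n, U n →L[ℂ] Y} (hj : Dense (⋃ n, Set.range (j n))) (hk : Dense (⋃ n, Set.range (k n)))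
    (hmono : Monotone fun n => Set.range (sumMap (j n) (k n))) :
    Dense (⋃ n, Set.range (sumMap (j n) (k n))) := by
  have hm : Monotone fun n => LinearMap.range (sumMap (j n) (k n)).toLinearMap := hmono
  have hU : (⋃ n, Set.range (sumMap (j n) (k n))) =
      ((⨆ n, LinearMap.range (sumMap (j n) (k n)).toLinearMap : Submodule ℂ (X.directSum Y)) :
        Set (X.directSum Y)) := (Submodule.coe_iSup_of_directed _ hm.directed_le).symm
  rw [hU]
  set N : Submodule ℂ (X.directSum Y) := ⨆ n, LinearMap.range (sumMap (j n) (k n)).toLinearMap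
  intro z
  have h1 : sumInl (sumFst z) ∈ N.topologicalClosure :=
    map_mem_closure sumInl.continuous (hj (sumFst z)) fun x hx => by
      obtain ⟨n, v, rfl⟩ := Set.mem_iUnion.mp hx
      exact Submodule.mem_iSup_of_mem n ⟨sumInl v, by simp⟩
  have h2 : sumInr (sumSnd z) ∈ N.topologicalClosure :=
    map_mem_closure sumInr.continuous (hk (sumSnd z)) fun x hx => by
      obtain ⟨n, v, rfl⟩ := Set.mem_iUnion.mp hx
      exact Submodule.mem_iSup_of_mem n ⟨sumInr v, by simp⟩
  rw [← sumInl_add_sumInr z]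
  exact N.topologicalClosure.add_mem h1 h2

end DirectSum

/-! ### Cuntz comparison of countably generated modules -/

namespace CGModule

/-- `W ⋐ X`: the countably generated module `W` embeds compactly in `X`. -/
def IsCompactIn (W X : CGModule A) : Prop :=
  CompactlyEmbeds W.toHilbertModule X.toHilbertModule

local infix:50 " ⋐ " => IsCompactIn

/-- Cuntz subequivalence is inclusion of the classes of compactly embedded modules. -/
theorem le_iff {X Y : CGModule A} : X ≤ Y ↔ ∀ W : CGModule A, W ⋐ X → W ⋐ Y := by
  constructor
  · intro h W hW
    obtain ⟨X₀, hX₀, ⟨e⟩⟩ := compactlyEmbeds_iff.mp hW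
    obtain ⟨Y₀, hY₀, ⟨f⟩⟩ := h X₀ (W.countablyGenerated.of_iso e) hX₀
    exact compactlyEmbeds_iff.mpr ⟨Y₀, hY₀, ⟨e.trans f⟩⟩
  · intro h X₀ hcg hX₀
    exact compactlyEmbeds_iff.mp
      (h ⟨X₀.toHilbertModule, hcg⟩ (compactlyEmbeds_iff.mpr ⟨X₀, hX₀, ⟨Iso.refl _⟩⟩))

theorem le_of_isEmbedding {X Y : CGModule A} {i : X.toHilbertModule →L[ℂ] Y.toHilbertModule}
    (hi : IsEmbedding i) : X ≤ Y :=
  le_iff.mpr fun _ hW => hW.comp_right hi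

theorem IsCompactIn.le {W X : CGModule A} (h : W ⋐ X) : W ≤ X := by
  obtain ⟨i, hi, -⟩ := h
  exact le_of_isEmbedding hi

theorem IsCompactIn.trans_le {W X Y : CGModule A} (h : W ⋐ X) (hXY : X ≤ Y) : W ⋐ Y :=
  le_iff.mp hXY W h

theorem IsCompactIn.trans {W X Y : CGModule A} (h : W ⋐ X) (k : X ⋐ Y) : W ⋐ Y :=
  h.trans_le k.le

theorem IsCompactIn.directSum {W X W' X' : CGModule A} (h : W ⋐ X) (k : W' ⋐ X') :
    W.directSum W' ⋐ X.directSum X' :=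
  CompactlyEmbeds.directSum h k

/-- A countably generated module is exhausted by a sequence of modules, each compactly embedded in
the next. -/
theorem exists_seq_isCompactIn (X : CGModule A) :
    ∃ v : ℕ → CGModule A, (∀ n, v n ⋐ X) ∧ (∀ n, v n ⋐ v (n + 1)) ∧
      ∀ W : CGModule A, W ⋐ X → ∃ n, W ⋐ v n := by
  obtain ⟨V, j, hj, hmono, hd, hV⟩ := exists_exhaustion X
  have hle : Monotone V := fun m n hmn => by
    obtain ⟨k, hk⟩ := exists_isEmbedding_of_range_subset (hj m) (hj n) (hmono hmn)
    exact le_of_isEmbedding hk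
  have hex : ∀ W : CGModule A, W ⋐ X → ∃ n, W ⋐ V n := fun W hW =>
    CompactlyEmbeds.exists_of_dense hj hmono hd hW
  have hnext : ∀ n, ∃ k, n < k ∧ V n ⋐ V k := fun n => by
    obtain ⟨k, hk⟩ := hex (V n) (hV n)
    exact ⟨max k (n + 1), by lia, hk.trans_le (hle (le_max_left _ _))⟩
  choose f hf hVf using hnext
  have hs : ∀ i, f^[i + 1] 0 = f (f^[i] 0) := fun i => Function.iterate_succ_apply' f i 0
  have hsm : StrictMono fun i => f^[i] 0 := strictMono_nat_of_lt_succ fun i => by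
    rw [hs]; exact hf _
  refine ⟨fun i => V (f^[i] 0), fun i => hV _, fun i => ?_, fun W hW => ?_⟩
  · simp only [hs]
    exact hVf _
  · obtain ⟨n, hn⟩ := hex W hW
    exact ⟨n, hn.trans_le (hle (hsm.le_apply (x := n)))⟩

/-- A direct sum is exhausted by direct sums of modules that embed compactly in the summands. -/
theorem exists_seq_directSum (X Y : CGModule A) :
    ∃ v w : ℕ → CGModule A, (∀ n, v n ⋐ X) ∧ (∀ n, w n ⋐ Y) ∧
      ∀ W : CGModule A, W ⋐ X.directSum Y → ∃ n, W ⋐ (v n).directSum (w n) := by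
  obtain ⟨V, j, hj, hjm, hjd, hV⟩ := exists_exhaustion X
  obtain ⟨U, k, hk, hkm, hkd, hU⟩ := exists_exhaustion Y
  have hmono : Monotone fun n => Set.range (sumMap (j n) (k n)) := by
    rintro m n hmn _ ⟨z, rfl⟩
    obtain ⟨v, hv⟩ := hjm hmn ⟨sumFst z, rfl⟩
    obtain ⟨u, hu⟩ := hkm hmn ⟨sumSnd z, rfl⟩
    exact ⟨sumInl v + sumInr u, by simp [hv, hu]⟩
  exact ⟨V, U, hV, hU, fun W hW => CompactlyEmbeds.exists_of_dense
    (fun n => (hj n).sumMap (hk n)) hmono (dense_iUnion_range_sumMap hjd hkd hmono) hW⟩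

theorem directSum_mono {X X' Y Y' : CGModule A} (h : X ≤ X') (k : Y ≤ Y') :
    X.directSum Y ≤ X'.directSum Y' := by
  obtain ⟨v, w, hv, hw, hex⟩ := exists_seq_directSum X Y
  refine le_iff.mpr fun W hW => ?_
  obtain ⟨n, hn⟩ := hex W hW
  exact hn.trans (((hv n).trans_le h).directSum ((hw n).trans_le k))

theorem directSum_comm_le (X Y : CGModule A) : X.directSum Y ≤ Y.directSum X :=
  le_of_isEmbedding isEmbedding_sumComm

theorem directSum_assoc_le (X Y Z : CGModule A) :
    (X.directSum Y).directSum Z ≤ X.directSum (Y.directSum Z) :=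
  le_of_isEmbedding isEmbedding_sumAssoc

theorem directSum_assoc_ge (X Y Z : CGModule A) :
    X.directSum (Y.directSum Z) ≤ (X.directSum Y).directSum Z :=
  calc X.directSum (Y.directSum Z) ≤ (Y.directSum Z).directSum X := directSum_comm_le _ _
    _ ≤ Y.directSum (Z.directSum X) := directSum_assoc_le _ _ _
    _ ≤ (Z.directSum X).directSum Y := directSum_comm_le _ _
    _ ≤ Z.directSum (X.directSum Y) := directSum_assoc_le _ _ _
    _ ≤ (X.directSum Y).directSum Z := directSum_comm_le _ _

theorem le_directSum_left (X Y : CGModule A) : X ≤ X.directSum Y :=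
  le_of_isEmbedding isEmbedding_sumInl

theorem directSum_zero_le (X : CGModule A) : X.directSum (CGModule.zero A) ≤ X :=
  le_of_isEmbedding isEmbedding_sumFst_zero

theorem zero_le (X : CGModule A) : CGModule.zero A ≤ X :=
  ((le_directSum_left _ _).trans (directSum_comm_le _ _)).trans (directSum_zero_le X)

/-- An increasing sequence of countably generated modules has a supremum `Z`, which moreover has
the property that a module compactly embedded in `Z` is compactly embedded in a member of the
sequence.  It is the inductive limit of suitable submodules of the members of the sequence. -/
theorem exists_sup {X : ℕ → CGModule A} (hX : Monotone X) :
    ∃ Z : CGModule A, (∀ n, X n ≤ Z) ∧ ∀ W : CGModule A, W ⋐ Z → ∃ n, W ⋐ X n := by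
  choose v hvX hvv hex using fun n => exists_seq_isCompactIn (X n)
  have hvm : ∀ n, Monotone (v n) := fun n => monotone_nat_of_le_succ fun k => (hvv n k).le
  have hev : ∀ n (W : CGModule A), W ⋐ X n → ∀ᶠ k in atTop, W ⋐ v n k := fun n W hW => by
    obtain ⟨k, hk⟩ := hex n W hW
    exact eventually_atTop.mpr ⟨k, fun l hl => hk.trans_le (hvm n hl)⟩
  -- the next submodule has to absorb both the previous one and finitely many members of the
  -- exhaustions of the earlier modules
  have hstep : ∀ n i, ∃ k, v n i ⋐ v (n + 1) k ∧
      ∀ m ∈ Set.Iic (n + 1), v m (n + 1) ⋐ v (n + 1) k := fun n i => by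
    refine ((hev (n + 1) _ ((hvX n i).trans_le (hX n.le_succ))).and ?_).exists
    exact (eventually_all_finite (Set.finite_Iic (n + 1))).mpr fun m hm =>
      hev (n + 1) _ ((hvX m (n + 1)).trans_le (hX hm))
  choose g hg hg' using hstep
  let s : ℕ → ℕ := fun n => Nat.rec 0 (fun n i => g n i) n
  let Y : ℕ → CGModule A := fun n => v n (s n)
  have hYY : ∀ n, Y n ⋐ Y (n + 1) := fun n => hg n (s n)
  have hvY : ∀ m n, m ≤ n + 1 → v m (n + 1) ⋐ Y (n + 1) := fun m n hmn => hg' n (s n) m hmn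
  choose φ hφ _ using hYY
  obtain ⟨Z, j, hj, hmono, hd⟩ := exists_inductiveLimit hφ
  refine ⟨⟨Z, countablyGenerated_of_dense (fun n => (Y n).countablyGenerated) hj hd⟩,
    fun m => le_iff.mpr fun W hW => ?_, fun W hW => ?_⟩
  · obtain ⟨k, hk⟩ := hex m W hW
    have h1 : W ⋐ v m (max m k + 1) := hk.trans_le (hvm m (by lia))
    exact (h1.trans (hvY m (max m k) (by lia))).comp_right (hj _)
  · obtain ⟨n, hn⟩ := CompactlyEmbeds.exists_of_dense hj hmono hd hW
    exact ⟨n, IsCompactIn.trans (X := Y n) hn (hvX n _)⟩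

end CGModule

/-! ### The ordered semigroup `Cu(A)` -/

section Semigroup

open CGModule

theorem Cu.mk_surjective : Function.Surjective (Cu.mk : CGModule A → Cu A) := Quotient.exists_rep

theorem Cu.mk_mono {X Y : CGModule A} : X ≤ Y → Cu.mk X ≤ Cu.mk Y := Cu.mk_le_mk_iff.mpr

theorem Cu.mk_eq {X Y : CGModule A} (h : X ≤ Y) (k : Y ≤ X) : Cu.mk X = Cu.mk Y :=
  Cu.mk_eq_mk_iff.mpr ⟨h, k⟩

/-- Addition of classes of modules is induced by the direct sum. -/
noncomputable local instance : Add (Cu A) :=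
  ⟨Quotient.map₂ CGModule.directSum fun _ _ h _ _ k =>
    ⟨directSum_mono h.1 k.1, directSum_mono h.2 k.2⟩⟩

/-- The zero element is the class of the zero module. -/
noncomputable local instance : Zero (Cu A) := ⟨Cu.mk (CGModule.zero A)⟩

variable (A) in
/-- The abelian semigroup `Cu(A)`. -/
noncomputable local instance Cu.addCommMonoid : AddCommMonoid (Cu A) where
  add_assoc := by
    rintro ⟨X⟩ ⟨Y⟩ ⟨Z⟩
    exact Cu.mk_eq (directSum_assoc_le X Y Z) (directSum_assoc_ge X Y Z)
  zero_add := by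
    rintro ⟨X⟩
    exact Cu.mk_eq ((directSum_comm_le _ _).trans (directSum_zero_le X))
      ((le_directSum_left _ _).trans (directSum_comm_le _ _))
  add_zero := by
    rintro ⟨X⟩
    exact Cu.mk_eq (directSum_zero_le X) (le_directSum_left _ _)
  add_comm := by
    rintro ⟨X⟩ ⟨Y⟩
    exact Cu.mk_eq (directSum_comm_le _ _) (directSum_comm_le _ _)
  nsmul := nsmulRec

/-- Increasing sequences in `Cu(A)` have suprema. -/
theorem Cu.exists_isLUB_seq {x : ℕ → Cu A} (hx : Monotone x) :
    ∃ Z : CGModule A, IsLUB (Set.range x) (Cu.mk Z) ∧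
      ∀ W : CGModule A, W.IsCompactIn Z → ∃ n, Cu.mk W ≤ x n := by
  choose X hX using fun n => Cu.mk_surjective (x n)
  have hXm : Monotone X := fun m n hmn => Cu.mk_le_mk_iff.mp (by rw [hX, hX]; exact hx hmn)
  obtain ⟨Z, hZ, hex⟩ := exists_sup hXm
  refine ⟨Z, ⟨?_, fun y hy => ?_⟩, fun W hW => ?_⟩
  · rintro _ ⟨n, rfl⟩
    exact hX n ▸ Cu.mk_mono (hZ n)
  · obtain ⟨Y, rfl⟩ := Cu.mk_surjective y
    refine Cu.mk_mono (le_iff.mpr fun W hW => ?_)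
    obtain ⟨n, hn⟩ := hex W hW
    refine hn.trans_le (Cu.mk_le_mk_iff.mp ?_)
    rw [hX]
    exact hy ⟨n, rfl⟩
  · obtain ⟨n, hn⟩ := hex W hW
    exact ⟨n, hX n ▸ Cu.mk_mono hn.le⟩

/-- Compact containment implies the relation `≪` of the classes. -/
theorem CGModule.IsCompactIn.wayBelow {W X : CGModule A} (h : W.IsCompactIn X) :
    WayBelow (Cu.mk W) (Cu.mk X) := by
  intro x s hx hs hXs
  obtain ⟨Z, hZ, hex⟩ := Cu.exists_isLUB_seq hx
  rw [hs.unique hZ] at hXs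
  exact hex W (h.trans_le (Cu.mk_le_mk_iff.mp hXs))

theorem WayBelow.le_trans {S : Type*} [PartialOrder S] {x y z : S} (hxy : x ≤ y)
    (h : WayBelow y z) : WayBelow x z := fun v s hv hs hzs =>
  (h v s hv hs hzs).imp fun _ hn => hxy.trans hn

/-- Every class is the supremum of a sequence of classes of modules, each compactly embedded in the
next, and this sequence is cofinal among the elements way below the class. -/
theorem Cu.exists_seq (x : Cu A) : ∃ (X : CGModule A) (v : ℕ → CGModule A), Cu.mk X = x ∧
    (∀ n, (v n).IsCompactIn X) ∧ (∀ n, (v n).IsCompactIn (v (n + 1))) ∧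
    IsLUB (Set.range fun n => Cu.mk (v n)) x ∧ ∀ y, WayBelow y x → ∃ n, y ≤ Cu.mk (v n) := by
  obtain ⟨X, rfl⟩ := Cu.mk_surjective x
  obtain ⟨v, hvX, hvv, hex⟩ := exists_seq_isCompactIn X
  have hlub : IsLUB (Set.range fun n => Cu.mk (v n)) (Cu.mk X) := by
    refine ⟨?_, fun y hy => ?_⟩
    · rintro _ ⟨n, rfl⟩
      exact Cu.mk_mono (hvX n).le
    · obtain ⟨Y, rfl⟩ := Cu.mk_surjective y
      refine Cu.mk_mono (le_iff.mpr fun W hW => ?_)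
      obtain ⟨n, hn⟩ := hex W hW
      exact hn.trans_le (Cu.mk_le_mk_iff.mp (hy ⟨n, rfl⟩))
  exact ⟨X, v, rfl, hvX, hvv, hlub, fun y hy => hy _ _
    (monotone_nat_of_le_succ fun n => Cu.mk_mono (hvv n).le) hlub le_rfl⟩

/-- A countable directed set has the same upper bounds as an increasing sequence of its elements. -/
theorem exists_monotone_seq {S : Type*} [PartialOrder S] {D : Set S} (hc : D.Countable)
    (hne : D.Nonempty) (hD : DirectedOn (· ≤ ·) D) :
    ∃ v : ℕ → S, Monotone v ∧ (∀ n, v n ∈ D) ∧ ∀ s, IsLUB D s ↔ IsLUB (Set.range v) s := by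
  have := hc.to_subtype
  have := hne.to_subtype
  have : Inhabited D := Classical.inhabited_of_nonempty this
  have := Encodable.ofCountable D
  have hdir : Directed (· ≤ ·) ((↑) : D → S) := directedOn_iff_directed.mp hD
  let v : ℕ → S := fun n => hdir.sequence _ n
  refine ⟨v, hdir.sequence_mono, fun n => Subtype.coe_prop _, fun s => ?_⟩
  have : upperBounds D = upperBounds (Set.range v) := by
    ext b
    constructor
    · rintro hb _ ⟨n, rfl⟩
      exact hb (Subtype.coe_prop _)
    · intro hb d hd
      exact (hdir.rel_sequence ⟨d, hd⟩).trans (hb ⟨_, rfl⟩)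
  rw [IsLUB, IsLUB, this]

/-- The defining property of `≪`, for countable directed sets. -/
theorem WayBelow.exists_mem_le {S : Type*} [PartialOrder S] {x s : S} (h : WayBelow x s)
    {D : Set S} (hc : D.Countable) (hne : D.Nonempty) (hD : DirectedOn (· ≤ ·) D)
    (hs : IsLUB D s) : ∃ d ∈ D, x ≤ d := by
  obtain ⟨v, hv, hvD, hlub⟩ := exists_monotone_seq hc hne hD
  obtain ⟨n, hn⟩ := h v s hv ((hlub s).mp hs) le_rfl
  exact ⟨v n, hvD n, hn⟩

theorem Cu.mk_add_mk (X Y : CGModule A) : Cu.mk X + Cu.mk Y = Cu.mk (X.directSum Y) := rfl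

theorem Cu.add_le_add {x₁ x₂ y₁ y₂ : Cu A} (h₁ : x₁ ≤ y₁) (h₂ : x₂ ≤ y₂) :
    x₁ + x₂ ≤ y₁ + y₂ := by
  obtain ⟨X₁, rfl⟩ := Cu.mk_surjective x₁
  obtain ⟨X₂, rfl⟩ := Cu.mk_surjective x₂
  obtain ⟨Y₁, rfl⟩ := Cu.mk_surjective y₁
  obtain ⟨Y₂, rfl⟩ := Cu.mk_surjective y₂
  exact Cu.mk_mono (directSum_mono (Cu.mk_le_mk_iff.mp h₁) (Cu.mk_le_mk_iff.mp h₂))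

theorem Cu.isCuObject : IsCuObject (Cu A) where
  add_le_add _ _ _ _ := Cu.add_le_add
  exists_isLUB D hc hne hD := by
    obtain ⟨v, hv, -, hlub⟩ := exists_monotone_seq hc hne hD
    obtain ⟨Z, hZ, -⟩ := Cu.exists_isLUB_seq hv
    exact ⟨_, (hlub _).mpr hZ⟩
  directedOn_le x := by
    obtain ⟨X, v, rfl, hvX, hvv, -, hcof⟩ := Cu.exists_seq x
    have hm : Monotone fun n => Cu.mk (v n) :=
      monotone_nat_of_le_succ fun n => Cu.mk_mono (hvv n).le
    intro y hy z hz
    obtain ⟨m, hm'⟩ := hcof y hy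
    obtain ⟨n, hn⟩ := hcof z hz
    exact ⟨_, (hvX (max m n)).wayBelow, hm'.trans (hm (le_max_left m n)),
      hn.trans (hm (le_max_right m n))⟩
  directedOn_wayBelow x := by
    obtain ⟨X, v, rfl, hvX, hvv, -, hcof⟩ := Cu.exists_seq x
    have hm : Monotone fun n => Cu.mk (v n) :=
      monotone_nat_of_le_succ fun n => Cu.mk_mono (hvv n).le
    intro y hy z hz
    obtain ⟨m, hm'⟩ := hcof y hy
    obtain ⟨n, hn⟩ := hcof z hz
    have hmn := (hvv (max m n)).wayBelow
    exact ⟨_, (hvX (max m n + 1)).wayBelow,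
      WayBelow.le_trans (hm'.trans (hm (le_max_left m n))) hmn,
      WayBelow.le_trans (hn.trans (hm (le_max_right m n))) hmn⟩
  exists_rapidly_increasing x := by
    obtain ⟨X, v, rfl, hvX, hvv, hlub, -⟩ := Cu.exists_seq x
    exact ⟨fun n => Cu.mk (v n), fun n => (hvX n).wayBelow, fun n => (hvv n).wayBelow, hlub⟩
  directedOn_add D₁ D₂ _ _ h₁ _ _ h₂ := by
    rintro _ ⟨a, ha, b, hb, rfl⟩ _ ⟨c, hc, d, hd, rfl⟩
    obtain ⟨e, he, hae, hce⟩ := h₁ a ha c hc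
    obtain ⟨f, hf, hbf, hdf⟩ := h₂ b hb d hd
    exact ⟨e + f, Set.add_mem_add he hf, Cu.add_le_add hae hbf, Cu.add_le_add hce hdf⟩
  isLUB_add D₁ D₂ hc₁ hne₁ h₁ hc₂ hne₂ h₂ s₁ s₂ hs₁ hs₂ := by
    refine ⟨?_, fun u hu => ?_⟩
    · rintro _ ⟨a, ha, b, hb, rfl⟩
      exact Cu.add_le_add (hs₁.1 ha) (hs₂.1 hb)
    · obtain ⟨X, rfl⟩ := Cu.mk_surjective s₁
      obtain ⟨Y, rfl⟩ := Cu.mk_surjective s₂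
      obtain ⟨U, rfl⟩ := Cu.mk_surjective u
      obtain ⟨v, w, hv, hw, hex⟩ := exists_seq_directSum X Y
      refine Cu.mk_mono (le_iff.mpr fun W hW => ?_)
      obtain ⟨n, hn⟩ := hex W hW
      obtain ⟨a, ha, hva⟩ := (hv n).wayBelow.exists_mem_le hc₁ hne₁ h₁ hs₁
      obtain ⟨b, hb, hwb⟩ := (hw n).wayBelow.exists_mem_le hc₂ hne₂ h₂ hs₂
      exact hn.trans_le (Cu.mk_le_mk_iff.mp
        ((Cu.add_le_add hva hwb).trans (hu (Set.add_mem_add ha hb))))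
  wayBelow_add x₁ x₂ y₁ y₂ h₁ h₂ := by
    obtain ⟨Y₁, v, rfl, hv, -, -, hcv⟩ := Cu.exists_seq y₁
    obtain ⟨Y₂, w, rfl, hw, -, -, hcw⟩ := Cu.exists_seq y₂
    obtain ⟨m, hm⟩ := hcv x₁ h₁
    obtain ⟨n, hn⟩ := hcw x₂ h₂
    exact WayBelow.le_trans (Cu.add_le_add hm hn) ((hv m).directSum (hw n)).wayBelow
  zero_le x := by
    obtain ⟨X, rfl⟩ := Cu.mk_surjective x
    exact Cu.mk_mono (CGModule.zero_le X)

end Semigroup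

end Cuntz

theorem mainTheorem2 (A : Type u) [NonUnitalCStarAlgebra A] [PartialOrder A] [StarOrderedRing A] :
    ∃ _ : AddCommMonoid (Cuntz.Cu A),
      (∀ X Y : Cuntz.CGModule A, Cuntz.Cu.mk X + Cuntz.Cu.mk Y = Cuntz.Cu.mk (X.directSum Y)) ∧
      (0 : Cuntz.Cu A) = Cuntz.Cu.mk (Cuntz.CGModule.zero A) ∧
      Cuntz.IsCuObject (Cuntz.Cu A) :=
  ⟨Cuntz.Cu.addCommMonoid A, Cuntz.Cu.mk_add_mk, rfl, Cuntz.Cu.isCuObject⟩
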